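/- Let $\Sigma$ be a finite set of events, $\checkmark\notin\Sigma$, and let $\Sigma^{*\checkmark}$ be the set of finite sequences over $\Sigma$ that may end with $\checkmark$ (traces). CSP terms are given by $$P ::= \mathrm{STOP}\mid a\to P\mid \mathrm{SKIP}\mid P_1\sqcap P_2\mid P_1\,\square\,P_2\mid P_1\parallel_A P_2\mid P_1;P_2\mid P\setminus A\mid P[R]\mid X\mid \mu X.P\mid \mathrm{DIV},$$ with $a\in\Sigma$, $A\subseteq\Sigma$, $R$ a binary relation on $\Sigma$ and $X$ a process variable; $\mu X$ binds $X$, and a term is closed if it has no free variables, otherwise open. **Semantics.** $\mathcal T^{\Downarrow}$ is the set of pairs $(T,D)$ with $D\subseteq T\subseteq\Sigma^{*\checkmark}$ such that $T$ is non-empty and prefix-closed; $s\langle\checkmark\rangle\in D$ implies $s\in D$; and $s\in D\cap\Sigma^*$, $t\in\Sigma^{*\checkmark}$ imply $st\in D$. Ordered by $(T_1,D_1)\sqsubseteq(T_2,D_2)$ iff $T_2\subseteq T_1$ and $D_2\subseteq D_1$, it is a complete lattice. The operators act on $\mathcal T^{\Downarrow}$ as follows, where $T_i,D_i$ (or $T,D$)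 are the components of the arguments and $r$ ranges over $\Sigma^{*\checkmark}$. * $\mathrm{STOP}=(\{\langle\rangle\},\emptyset)$; $\mathrm{SKIP}=(\{\langle\rangle,\langle\checkmark\rangle\},\emptyset)$; $\mathrm{DIV}=(\Sigma^{*\checkmark},\Sigma^{*\checkmark})$. * $a\to P$: traces $\{\langle\rangle\}\cup\{\langle a\rangle t: t\in T\}$, divergences $\{\langle a\rangle t: t\in D\}$. * Both choices take componentwise unions. * $P_1;P_2$: divergences $D_1\cup\{ts: t\langle\checkmark\rangle\in T_1, s\in D_2\}$; traces $(T_1\cap\Sigma^*)\cup\{ts: t\langle\checkmark\rangle\in T_1,s\in T_2\}$ together with the divergences. * $P_1\parallel_A P_2$: divergences $\{ur: u\in (s\parallel_A t)\cap\Sigma^*, s\in T_1,t\in T_2, (s\in D_1\text{ or }t\in D_2)\}$; traces $\bigcup\{s\parallel_A t: s\in T_1,t\in T_2\}$ together with the divergences. Here $s\parallel_A t$ is the set of all interleavings of $s$ and $t$ that synchronise on exactly the events of $A\cup\{\checkmark\}$ (it is empty if a synchronised event of one has no partner in the other). * $P\setminus A$, where $t\setminus A$ denotes deletion of the events of $A$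 (keeping $\checkmark$): divergences $\{(t\setminus A)r: t\in D\cap\Sigma^*\}\cup\{(u\setminus A)r: u\in\Sigma^\omega,\ u\setminus A\text{ finite},\ \text{every finite prefix of }u\text{ is in }T\}$; traces $\{t\setminus A: t\in T\}$ together with the divergences. * $P[R]$: divergences $\{tr: \exists s\in D\cap\Sigma^*,\ s\,R\,t\}$; traces $\{t:\exists s\in T,\ s\,R\,t\}$ together with the divergences, where $R$ is applied elementwise and relates $\checkmark$ only to itself. * $\mu X.P$ denotes the $\sqsubseteq$-least fixed point of $P$ as a function of $X$, the values of the other variables being fixed. Thus a term $P$ with free variables among $X,Y_1,\dots,Y_n$ defines a map $(T,\bar\theta)\mapsto P(T,\bar\theta)$ from $(\mathcal T^{\Downarrow})^{n+1}$ to $\mathcal T^{\Downarrow}$. **Metrics.** For $U\subseteq\Sigma$ let $\mathrm{length}_U(s)$ be the number of occurrences in $s$ of events from $U$. For $n\in\mathbb N$ put $(T,D)\restriction_U n=(T',D')$ with $D'=D\cup\{st: s\in T\cap\Sigma^*,\ \mathrm{length}_U(s)=n,\ t\in\Sigma^{*\checkmark}\}$ and $T'=D'\cup\{s\in T:\mathrm{length}_U(s)\le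 n\}$, and $$d_U(p,q)=\inf\{2^{-n}: p\restriction_U n=q\restriction_U n\}.$$ **The sets $N_X$, $G$, $C_X$, $F$.** Write $\mathcal P=\mathcal P(\Sigma)$ and $R(U)=\{y:\exists x\in U,\ x\,R\,y\}$. The following are defined by recursion on terms. $N_X(P)=\mathcal P\times\mathcal P$ if $X$ is not free in $P$; otherwise $N_X(a\to P)=N_X(P)$; $N_X(P_1\oplus P_2)=N_X(P_1)\cap N_X(P_2)$ for $\oplus\in\{\sqcap,\square,;,\parallel_A\}$; $N_X(P\setminus A)=\{(U,V):\exists V',\ (U,V')\in N_X(P),\ V'\cap A=\emptyset,\ V'\subseteq V\}$; $N_X(P[R])=\{(U,V):\exists V',\ (U,V')\in N_X(P),\ R(V')\subseteq V\}$; $N_X(X)=\{(U,V):U\subseteq V\}$; $N_X(\mu Y.P)=\{(U,V):\exists U',V',\ (U',V')\in N_X(P),\ (V',V')\in N_Y(P),\ U\subseteq U',\ V'\subseteq V\}$ for $Y\ne X$. $G(\mathrm{STOP})=\mathcal P$; $G(\mathrm{SKIP})=G(\mathrm{DIV})=G(X)=\emptyset$; $G(a\to P)=G(P)\cup\{V:a\in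 V\}$; $G(P_1\oplus P_2)=G(P_1)\cap G(P_2)$ for $\oplus\in\{\sqcap,\square\}$; $G(P_1;P_2)$ is $G(P_1)\cup G(P_2)$ if $P_1$ is closed and $F(P_1)\neq\emptyset$, and $G(P_1)$ otherwise; $G(P_1\parallel_A P_2)$ is $G(P_1)\cup G(P_2)$ if $P_1,P_2$ are both closed and $F(P_1),F(P_2)\ne\emptyset$, and $G(P_1)\cap G(P_2)$ otherwise; $G(P\setminus A)$ is $\{V:\exists V'\in G(P),\ V'\cap A=\emptyset,\ V'\subseteq V\}$ if $P$ is closed and $(\emptyset,\Sigma\setminus A)\in F(P)$, and $\emptyset$ otherwise; $G(P[R])=\{V:\exists V'\in G(P),\ R(V')\subseteq V\}$; $G(\mu X.P)=G(P)$. $C_X(P)=\mathcal P\times\mathcal P$ if $X$ is not free in $P$; otherwise $C_X(a\to P)=C_X(P)\cup\{(U,V)\in N_X(P):a\in V\}$; $C_X(P_1\oplus P_2)=C_X(P_1)\cap C_X(P_2)$ for $\oplus\in\{\sqcap,\square,\parallel_A\}$; $C_X(P_1;P_2)=C_X(P_1)\cap\bigl(C_X(P_2)\cup\{(U,V)\in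 N_X(P_2):V\in G(P_1)\}\bigr)$; $C_X(P\setminus A)=\{(U,V):\exists V',\ (U,V')\in C_X(P),\ V'\cap A=\emptyset,\ V'\subseteq V\}$; $C_X(P[R])=\{(U,V):\exists V',\ (U,V')\in C_X(P),\ R(V')\subseteq V\}$; $C_X(X)=\emptyset$; $C_X(\mu Y.P)=\{(U,V):\exists U',V',\ (U',V')\in C_X(P),\ (V',V')\in N_Y(P),\ U\subseteq U',\ V'\subseteq V\}$ for $Y\neq X$. $F(\mathrm{STOP})=F(\mathrm{SKIP})=\mathcal P\times\mathcal P$; $F(\mathrm{DIV})=\emptyset$; $F(a\to P)=F(P)$; $F(P_1\oplus P_2)=F(P_1)\cap F(P_2)$ for $\oplus\in\{\sqcap,\square,;\}$; $F(P_1\parallel_A P_2)=(F(P_1)\cap F(P_2))\cup\{(U_1\cap U_2,V_1):(U_1,V_1)\in F(P_1),(U_2,A)\in F(P_2)\}\cup\{(U_1\cap U_2,V_2):(U_2,V_2)\in F(P_2),(U_1,A)\in F(P_1)\}$; $F(P\setminus A)=\{(U,V):\exists V',\ (U,V')\in F(P),\ V'\cap A=\emptyset,\ V'\subseteq V\}$;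 $F(P[R])=\{(U,V):\exists V',\ (U,V')\in F(P),\ R(V')\subseteq V\}$; $F(X)=\{(U,V):U\subseteq V\}$; $F(\mu X.P)$ is the set of $(U,V)$ for which there is $W$ with $(W,W)\in C_X(P)\cap F(P)$, $W\subseteq V$ and, if $\mu X.P$ is open, also $U\subseteq W$. **Proposition.** Let $P(X,Y_1,\dots,Y_n)=P(X,\bar Y)$ be a CSP term whose free variables are contained in $\{X,Y_1,\dots,Y_n\}$. If $(U,V)\in C_X(P)$, then for all $T_1,T_2,\theta_1,\dots,\theta_n\in\mathcal T^{\Downarrow}$, $$d_V\bigl(P(T_1,\bar\theta),P(T_2,\bar\theta)\bigr)\le\tfrac12\,d_U(T_1,T_2).$$ -/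

import Mathlib

/-!
Syntax and denotational semantics of CSP in the traces/divergences model, the family of
metrics `d_U`, and the static analysis by nonexpansive, guard, contractive and fair sets.
The alphabet is `Evt`, the set of variables is `Var`.
-/

namespace CSP

universe u v

/-- CSP terms. Renaming is along a binary relation on events; variables are bound by `mu`. -/
inductive Term (Evt : Type u) (Var : Type v) : Type (max u v) where
  | deadlock : Term Evt Var
  | pre (a : Evt) (P : Term Evt Var) : Term Evt Var
  | skip : Term Evt Var
  | intChoice (P Q : Term Evt Var) : Term Evt Var
  | extChoice (P Q : Term Evt Var) : Term Evt Var
  | par (A : Set Evt) (P Q : Term Evt Var) : Term Evt Var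
  | seq (P Q : Term Evt Var) : Term Evt Var
  | hide (P : Term Evt Var) (A : Set Evt) : Term Evt Var
  | rename (P : Term Evt Var) (R : Evt → Evt → Prop) : Term Evt Var
  | var (X : Var) : Term Evt Var
  | mu (X : Var) (P : Term Evt Var) : Term Evt Var
  | div : Term Evt Var

/-- The free variables of a term. -/
def Term.freeVars {Evt : Type u} {Var : Type v} [DecidableEq Var] :
    Term Evt Var → Finset Var
  | .deadlock => ∅
  | .pre _ P => P.freeVars
  | .skip => ∅
  | .intChoice P Q => P.freeVars ∪ Q.freeVars
  | .extChoice P Q => P.freeVars ∪ Q.freeVars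
  | .par _ P Q => P.freeVars ∪ Q.freeVars
  | .seq P Q => P.freeVars ∪ Q.freeVars
  | .hide P _ => P.freeVars
  | .rename P _ => P.freeVars
  | .var X => {X}
  | .mu X P => P.freeVars.erase X
  | .div => ∅

/-- A term is closed if it has no free variables. -/
def Term.Closed {Evt : Type u} {Var : Type v} [DecidableEq Var] (P : Term Evt Var) : Prop :=
  P.freeVars = ∅

/-! ### Traces -/

/-- A finite trace: a finite sequence of events, followed by the termination signal `✓`
exactly when `tick = true`. The traces without `✓` are the `⟨s, false⟩`. -/
@[ext]
structure Trace (Evt : Type u) : Type u where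
  events : List Evt
  tick : Bool

namespace Trace

variable {Evt : Type u}

/-- The (non-strict) prefix order on traces. -/
def IsPrefix (s t : Trace Evt) : Prop :=
  s = t ∨ (s.tick = false ∧ s.events <+: t.events)

/-- Concatenation of a trace without `✓` and an arbitrary trace. -/
def cat (s : List Evt) (t : Trace Evt) : Trace Evt := ⟨s ++ t.events, t.tick⟩

open Classical in
/-- The number of occurrences in `s` of events from `U`. -/
noncomputable def length (U : Set Evt) (s : Trace Evt) : ℕ :=
  s.events.countP (fun a => decide (a ∈ U))

open Classical in
/-- Deletes the events of `A` from a sequence of events. -/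
noncomputable def hideList (A : Set Evt) (s : List Evt) : List Evt :=
  s.filter (fun a => decide (a ∉ A))

/-- Deletes the events of `A` from a trace; a final `✓` is kept. -/
noncomputable def hide (A : Set Evt) (s : Trace Evt) : Trace Evt :=
  ⟨hideList A s.events, s.tick⟩

/-- Element-wise lifting of a renaming relation to traces; `✓` is related to itself only. -/
def Rel (R : Evt → Evt → Prop) (s t : Trace Evt) : Prop :=
  List.Forall₂ R s.events t.events ∧ s.tick = t.tick

/-- `Interleave A s t u`: the sequence `u` is an interleaving of `s` and `t` in which `s` and `t`
synchronise on exactly the events of `A`. -/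
inductive Interleave (A : Set Evt) : List Evt → List Evt → List Evt → Prop
  | nil : Interleave A [] [] []
  | sync {a : Evt} {s t u : List Evt} : a ∈ A → Interleave A s t u →
      Interleave A (a :: s) (a :: t) (a :: u)
  | left {b : Evt} {s t u : List Evt} : b ∉ A → Interleave A s t u →
      Interleave A (b :: s) t (b :: u)
  | right {b : Evt} {s t u : List Evt} : b ∉ A → Interleave A s t u →
      Interleave A s (b :: t) (b :: u)

/-- `u ∈ s ∥[A] t`: synchronisation on the events of `A` and on `✓`. -/
def Par (A : Set Evt) (s t u : Trace Evt) : Prop :=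
  Interleave A s.events t.events u.events ∧ s.tick = u.tick ∧ t.tick = u.tick

/-- The prefix of length `k` of an infinite sequence of events. -/
def initSeg (w : ℕ → Evt) (k : ℕ) : List Evt := (List.range k).map w

theorem prefix_cat {s : List Evt} {r x : Trace Evt} (h : IsPrefix x (cat s r)) :
    (x.tick = false ∧ x.events <+: s) ∨ ∃ r', IsPrefix r' r ∧ x = cat s r' := by
  rcases h with rfl | ⟨h1, h2⟩
  · exact Or.inr ⟨r, Or.inl rfl, rfl⟩
  · rcases List.prefix_or_prefix_of_prefix h2 (List.prefix_append s r.events) with h | ⟨m, hm⟩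
    · exact Or.inl ⟨h1, h⟩
    · have h3 : s ++ m <+: s ++ r.events := hm ▸ h2
      exact Or.inr ⟨⟨m, false⟩, Or.inr ⟨rfl, (List.prefix_append_right_inj s).1 h3⟩,
        Trace.ext hm.symm h1⟩

theorem prefix_hideList {A : Set Evt} {s x : List Evt} (h : x <+: hideList A s) :
    ∃ y, y <+: s ∧ x = hideList A y := by
  classical
  induction s generalizing x with
  | nil => exact ⟨[], List.prefix_rfl, by simpa [hideList] using h⟩
  | cons a s ih =>
    by_cases ha : a ∈ A
    · have e : hideList A (a :: s) = hideList A s := by simp [hideList, ha]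
      obtain ⟨y, hy, rfl⟩ := ih (e ▸ h)
      exact ⟨a :: y, by simpa using hy, by simp [hideList, ha]⟩
    · have e : hideList A (a :: s) = a :: hideList A s := by simp [hideList, ha]
      rw [e] at h
      cases x with
      | nil => exact ⟨[], List.nil_prefix, rfl⟩
      | cons b x =>
        obtain ⟨rfl, hx⟩ := List.cons_prefix_cons.1 h
        obtain ⟨y, hy, rfl⟩ := ih hx
        exact ⟨b :: y, by simpa using hy, by simp [hideList, ha]⟩

theorem prefix_forall₂ {R : Evt → Evt → Prop} {s t x : List Evt} (h : List.Forall₂ R s t)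
    (hx : x <+: t) : ∃ y, y <+: s ∧ List.Forall₂ R y x := by
  induction h generalizing x with
  | nil => exact ⟨[], List.prefix_rfl, by simp_all⟩
  | cons hab _ ih =>
    cases x with
    | nil => exact ⟨[], List.nil_prefix, List.Forall₂.nil⟩
    | cons c x =>
      obtain ⟨rfl, hx₂⟩ := List.cons_prefix_cons.1 hx
      obtain ⟨y, hy, hyx⟩ := ih hx₂
      exact ⟨_ :: y, by simpa using hy, List.Forall₂.cons hab hyx⟩

theorem prefix_interleave {A : Set Evt} {s t w x : List Evt} (h : Interleave A s t w)
    (hx : x <+: w) : ∃ s' t', s' <+: s ∧ t' <+: t ∧ Interleave A s' t' x := by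
  induction h generalizing x with
  | nil => exact ⟨[], [], List.prefix_rfl, List.prefix_rfl, by simp_all [Interleave.nil]⟩
  | sync ha _ ih =>
    cases x with
    | nil => exact ⟨[], [], List.nil_prefix, List.nil_prefix, Interleave.nil⟩
    | cons c x =>
      obtain ⟨rfl, hx₂⟩ := List.cons_prefix_cons.1 hx
      obtain ⟨s', t', hs, ht, hi⟩ := ih hx₂
      exact ⟨c :: s', c :: t', by simpa using hs, by simpa using ht, .sync ha hi⟩
  | left hb _ ih =>
    cases x with
    | nil => exact ⟨[], [], List.nil_prefix, List.nil_prefix, Interleave.nil⟩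
    | cons c x =>
      obtain ⟨rfl, hx₂⟩ := List.cons_prefix_cons.1 hx
      obtain ⟨s', t', hs, ht, hi⟩ := ih hx₂
      exact ⟨c :: s', t', by simpa using hs, ht, .left hb hi⟩
  | right hb _ ih =>
    cases x with
    | nil => exact ⟨[], [], List.nil_prefix, List.nil_prefix, Interleave.nil⟩
    | cons c x =>
      obtain ⟨rfl, hx₂⟩ := List.cons_prefix_cons.1 hx
      obtain ⟨s', t', hs, ht, hi⟩ := ih hx₂
      exact ⟨s', c :: t', hs, by simpa using ht, .right hb hi⟩

end Trace

/-! ### The semantic model -/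

/-- The model: pairs `(T, D)`, where `D` is the set of divergences and `T` is the set of all
traces, including the divergences. Divergence is catastrophic (`postfix_closed`), so that in the
clauses below each operator adds its divergences to its traces. -/
@[ext]
structure Denot (Evt : Type u) : Type u where
  T : Set (Trace Evt)
  D : Set (Trace Evt)
  sub : D ⊆ T
  tick_mem : ∀ s : List Evt, ⟨s, true⟩ ∈ D → ⟨s, false⟩ ∈ D
  nonempty : T.Nonempty
  prefix_closed : ∀ s t : Trace Evt, s.IsPrefix t → t ∈ T → s ∈ T
  postfix_closed : ∀ (s : List Evt) (t : Trace Evt), ⟨s, false⟩ ∈ D → Trace.cat s t ∈ D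

namespace Denot

variable {Evt : Type u}

theorem nil_mem (P : Denot Evt) : ⟨[], false⟩ ∈ P.T := by
  obtain ⟨t, ht⟩ := P.nonempty
  exact P.prefix_closed _ t (Or.inr ⟨rfl, List.nil_prefix⟩) ht

theorem list_prefix_mem (P : Denot Evt) {s t : List Evt} {b : Bool} (h : s <+: t)
    (ht : ⟨t, b⟩ ∈ P.T) : ⟨s, false⟩ ∈ P.T :=
  P.prefix_closed _ _ (Or.inr ⟨rfl, h⟩) ht

theorem list_postfix_mem (P : Denot Evt) {s : List Evt} {b : Bool} (h : ⟨s, b⟩ ∈ P.D) :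
    ⟨s, false⟩ ∈ P.D := by
  cases b
  · exact h
  · exact P.tick_mem s h

/-- The refinement order: `P ≤ Q` iff `Q.T ⊆ P.T` and `Q.D ⊆ P.D`. -/
instance : PartialOrder (Denot Evt) where
  le P Q := Q.T ⊆ P.T ∧ Q.D ⊆ P.D
  le_refl _ := ⟨subset_rfl, subset_rfl⟩
  le_trans _ _ _ h k := ⟨k.1.trans h.1, k.2.trans h.2⟩
  le_antisymm _ _ h k := Denot.ext (k.1.antisymm h.1) (k.2.antisymm h.2)

/-- Least upper bounds are computed by intersecting both components. -/
instance : SupSet (Denot Evt) where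
  sSup S :=
    { T := {t | ∀ P ∈ S, t ∈ P.T}
      D := {t | ∀ P ∈ S, t ∈ P.D}
      sub := fun _ h P hP => P.sub (h P hP)
      tick_mem := fun s h P hP => P.tick_mem s (h P hP)
      nonempty := ⟨⟨[], false⟩, fun P _ => P.nil_mem⟩
      prefix_closed := fun s t h ht P hP => P.prefix_closed s t h (ht P hP)
      postfix_closed := fun s t h P hP => P.postfix_closed s t (h P hP) }

instance : CompleteLattice (Denot Evt) :=
  completeLatticeOfSup (Denot Evt) fun _ =>
    ⟨fun P hP => ⟨fun _ ht => ht P hP, fun _ ht => ht P hP⟩,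
      fun _ hQ => ⟨fun _ ht _ hP => (hQ hP).1 ht, fun _ ht _ hP => (hQ hP).2 ht⟩⟩

/-- Deadlock. -/
def deadlock : Denot Evt where
  T := {⟨[], false⟩}
  D := ∅
  sub := by simp
  tick_mem := by simp
  nonempty := by simp
  prefix_closed := by
    rintro s t (rfl | ⟨h1, h2⟩) ht
    · exact ht
    · obtain rfl : t = _ := ht
      exact Trace.ext (by simpa using h2) h1
  postfix_closed := by simp

/-- Successful termination. -/
def skip : Denot Evt where
  T := {⟨[], false⟩, ⟨[], true⟩}
  D := ∅
  sub := by simp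
  tick_mem := by simp
  nonempty := by simp
  prefix_closed := by
    rintro s t (rfl | ⟨h1, h2⟩) ht
    · exact ht
    · left
      rcases ht with rfl | rfl <;> exact Trace.ext (by simpa using h2) h1
  postfix_closed := by simp

/-- Livelock. -/
def div : Denot Evt where
  T := Set.univ
  D := Set.univ
  sub := subset_rfl
  tick_mem := fun _ _ => trivial
  nonempty := ⟨⟨[], false⟩, trivial⟩
  prefix_closed := fun _ _ _ _ => trivial
  postfix_closed := fun _ _ _ => trivial

/-- Event prefixing. -/
def pre (a : Evt) (P : Denot Evt) : Denot Evt where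
  T := {⟨[], false⟩} ∪ {t | ∃ s ∈ P.T, t = Trace.cat [a] s}
  D := {t | ∃ s ∈ P.D, t = Trace.cat [a] s}
  sub := by
    rintro _ ⟨s, hs, rfl⟩
    exact Or.inr ⟨s, P.sub hs, rfl⟩
  tick_mem := by
    rintro s ⟨⟨r, b⟩, hr, h⟩
    simp only [Trace.cat, Trace.mk.injEq] at h
    exact ⟨⟨r, false⟩, P.list_postfix_mem hr, by simp [Trace.cat, h.1]⟩
  nonempty := ⟨⟨[], false⟩, Or.inl rfl⟩
  prefix_closed := by
    rintro x t hx (rfl | ⟨s, hs, rfl⟩)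
    · exact Or.inl (deadlock.prefix_closed x _ hx rfl)
    · rcases Trace.prefix_cat hx with ⟨h1, h2⟩ | ⟨r, hr, rfl⟩
      · obtain ⟨x, b⟩ := x
        obtain rfl : b = false := h1
        cases x with
        | nil => exact Or.inl rfl
        | cons c x =>
          obtain ⟨rfl, hx₂⟩ := List.cons_prefix_cons.1 h2
          obtain rfl : x = [] := by simpa using hx₂
          exact Or.inr ⟨⟨[], false⟩, P.nil_mem, rfl⟩
      · exact Or.inr ⟨r, P.prefix_closed _ _ hr hs, rfl⟩
  postfix_closed := by
    rintro s t ⟨⟨r, b⟩, hr, h⟩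
    simp only [Trace.cat, Trace.mk.injEq] at h
    obtain ⟨rfl, rfl⟩ := h
    exact ⟨_, P.postfix_closed r t hr, by simp [Trace.cat]⟩

/-- Choice; internal and external choice coincide in this model. -/
def choice (P Q : Denot Evt) : Denot Evt where
  T := P.T ∪ Q.T
  D := P.D ∪ Q.D
  sub := Set.union_subset_union P.sub Q.sub
  tick_mem := fun s h => h.imp (P.tick_mem s) (Q.tick_mem s)
  nonempty := P.nonempty.mono Set.subset_union_left
  prefix_closed := fun s t h => Or.imp (P.prefix_closed s t h) (Q.prefix_closed s t h)
  postfix_closed := fun s t h => h.imp (P.postfix_closed s t) (Q.postfix_closed s t)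

/-- The divergences of a sequential composition. -/
def seqD (P Q : Denot Evt) : Set (Trace Evt) :=
  P.D ∪ {x | ∃ (t : List Evt) (s : Trace Evt), ⟨t, true⟩ ∈ P.T ∧ s ∈ Q.D ∧ x = Trace.cat t s}

/-- Sequential composition. -/
def seq (P Q : Denot Evt) : Denot Evt where
  T := {x | x ∈ P.T ∧ x.tick = false} ∪
    {x | ∃ (t : List Evt) (s : Trace Evt), ⟨t, true⟩ ∈ P.T ∧ s ∈ Q.T ∧ x = Trace.cat t s} ∪
    seqD P Q
  D := seqD P Q
  sub := Set.subset_union_right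
  tick_mem := by
    rintro x (h | ⟨t, ⟨r, b⟩, ht, hs, h⟩)
    · exact Or.inl (P.tick_mem x h)
    · simp only [Trace.cat, Trace.mk.injEq] at h
      exact Or.inr ⟨t, ⟨r, false⟩, ht, Q.list_postfix_mem hs, by simp [Trace.cat, h.1]⟩
  nonempty := ⟨⟨[], false⟩, Or.inl (Or.inl ⟨P.nil_mem, rfl⟩)⟩
  prefix_closed := by
    have key : ∀ (x : Trace Evt) (t : List Evt) (s : Trace Evt), ⟨t, true⟩ ∈ P.T → s ∈ Q.T →
        x.IsPrefix (Trace.cat t s) → (x ∈ P.T ∧ x.tick = false) ∨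
          ∃ (t : List Evt) (s : Trace Evt), ⟨t, true⟩ ∈ P.T ∧ s ∈ Q.T ∧ x = Trace.cat t s := by
      intro x t s ht hs hx
      rcases Trace.prefix_cat hx with ⟨h1, h2⟩ | ⟨r, hr, rfl⟩
      · exact Or.inl ⟨P.prefix_closed _ _ (Or.inr ⟨h1, h2⟩) ht, h1⟩
      · exact Or.inr ⟨t, r, ht, Q.prefix_closed _ _ hr hs, rfl⟩
    rintro x y hx ((⟨h1, h2⟩ | ⟨t, s, ht, hs, rfl⟩) | (h | ⟨t, s, ht, hs, rfl⟩))
    · refine Or.inl (Or.inl ⟨P.prefix_closed _ _ hx h1, ?_⟩)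
      rcases hx with rfl | ⟨h, -⟩
      · exact h2
      · exact h
    · exact Or.inl (key x t s ht hs hx)
    · rcases hx with rfl | ⟨h1, h2⟩
      · exact Or.inr (Or.inl h)
      · exact Or.inl (Or.inl ⟨P.prefix_closed _ _ (Or.inr ⟨h1, h2⟩) (P.sub h), h1⟩)
    · exact Or.inl (key x t s ht (Q.sub hs) hx)
  postfix_closed := by
    rintro x y (h | ⟨t, ⟨r, b⟩, ht, hs, h⟩)
    · exact Or.inl (P.postfix_closed x y h)
    · simp only [Trace.cat, Trace.mk.injEq] at h
      obtain ⟨rfl, rfl⟩ := h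
      exact Or.inr ⟨t, _, ht, Q.postfix_closed r y hs, by simp [Trace.cat]⟩

/-- The divergences of a parallel composition. -/
def parD (A : Set Evt) (P Q : Denot Evt) : Set (Trace Evt) :=
  {x | ∃ (s t : Trace Evt) (w : List Evt) (r : Trace Evt), s ∈ P.T ∧ t ∈ Q.T ∧
    Trace.Par A s t ⟨w, false⟩ ∧ (s ∈ P.D ∨ t ∈ Q.D) ∧ x = Trace.cat w r}

/-- Parallel composition, synchronising on `A` (and on termination). -/
def par (A : Set Evt) (P Q : Denot Evt) : Denot Evt where
  T := {x | ∃ s ∈ P.T, ∃ t ∈ Q.T, Trace.Par A s t x} ∪ parD A P Q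
  D := parD A P Q
  sub := Set.subset_union_right
  tick_mem := by
    rintro x ⟨s, t, w, r, hs, ht, h, hd, e⟩
    simp only [Trace.cat, Trace.mk.injEq] at e
    exact ⟨s, t, w, ⟨r.events, false⟩, hs, ht, h, hd, by simp [Trace.cat, e.1]⟩
  nonempty := ⟨⟨[], false⟩, Or.inl ⟨_, P.nil_mem, _, Q.nil_mem, .nil, rfl, rfl⟩⟩
  prefix_closed := by
    have key : ∀ x y s t : Trace Evt, s ∈ P.T → t ∈ Q.T → Trace.Par A s t y → x.IsPrefix y →
        ∃ s ∈ P.T, ∃ t ∈ Q.T, Trace.Par A s t x := by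
      rintro x y s t hs ht h (rfl | ⟨h1, h2⟩)
      · exact ⟨s, hs, t, ht, h⟩
      · obtain ⟨s', t', hs', ht', hi⟩ := Trace.prefix_interleave h.1 h2
        exact ⟨⟨s', false⟩, P.list_prefix_mem hs' hs, ⟨t', false⟩, Q.list_prefix_mem ht' ht,
          hi, h1.symm, h1.symm⟩
    rintro x y hx (⟨s, hs, t, ht, h⟩ | ⟨s, t, w, r, hs, ht, h, hd, rfl⟩)
    · exact Or.inl (key x y s t hs ht h hx)
    · rcases Trace.prefix_cat hx with h1 | ⟨r', -, rfl⟩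
      · exact Or.inl (key x _ s t hs ht h (Or.inr h1))
      · exact Or.inr ⟨s, t, w, r', hs, ht, h, hd, rfl⟩
  postfix_closed := by
    rintro x y ⟨s, t, w, r, hs, ht, h, hd, e⟩
    simp only [Trace.cat, Trace.mk.injEq] at e
    exact ⟨s, t, w, ⟨r.events ++ y.events, y.tick⟩, hs, ht, h, hd, by simp [Trace.cat, e.1]⟩

/-- The divergences of a hiding: either `P` diverges, or `P` performs an infinite sequence `w`
all but finitely many of whose events are hidden. -/
def hideD (P : Denot Evt) (A : Set Evt) : Set (Trace Evt) :=
  {x | ∃ (t : List Evt) (r : Trace Evt), ⟨t, false⟩ ∈ P.D ∧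
      x = Trace.cat (Trace.hideList A t) r} ∪
    {x | ∃ (w : ℕ → Evt) (N : ℕ) (r : Trace Evt), (∀ k, ⟨Trace.initSeg w k, false⟩ ∈ P.T) ∧
      (∀ i, N ≤ i → w i ∈ A) ∧ x = Trace.cat (Trace.hideList A (Trace.initSeg w N)) r}

/-- Hiding. -/
def hide (P : Denot Evt) (A : Set Evt) : Denot Evt where
  T := {x | ∃ t ∈ P.T, x = Trace.hide A t} ∪ hideD P A
  D := hideD P A
  sub := Set.subset_union_right
  tick_mem := by
    rintro x (⟨t, r, ht, e⟩ | ⟨w, N, r, hw, hN, e⟩) <;>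
      simp only [Trace.cat, Trace.mk.injEq] at e
    · exact Or.inl ⟨t, ⟨r.events, false⟩, ht, by simp [Trace.cat, e.1]⟩
    · exact Or.inr ⟨w, N, ⟨r.events, false⟩, hw, hN, by simp [Trace.cat, e.1]⟩
  nonempty := ⟨_, Or.inl ⟨_, P.nil_mem, rfl⟩⟩
  prefix_closed := by
    have key : ∀ (x : Trace Evt) (t : List Evt) (b : Bool), ⟨t, b⟩ ∈ P.T → x.tick = false →
        x.events <+: Trace.hideList A t → ∃ t ∈ P.T, x = Trace.hide A t := by
      intro x t b ht h1 h2
      obtain ⟨y, hy, e⟩ := Trace.prefix_hideList h2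
      exact ⟨⟨y, false⟩, P.list_prefix_mem hy ht, Trace.ext e h1⟩
    rintro x y hx (⟨t, ht, rfl⟩ | (⟨t, r, ht, rfl⟩ | ⟨w, N, r, hw, hN, rfl⟩))
    · rcases hx with rfl | ⟨h1, h2⟩
      · exact Or.inl ⟨t, ht, rfl⟩
      · exact Or.inl (key x t.events t.tick ht h1 h2)
    · rcases Trace.prefix_cat hx with ⟨h1, h2⟩ | ⟨r', -, rfl⟩
      · exact Or.inl (key x t false (P.sub ht) h1 h2)
      · exact Or.inr (Or.inl ⟨t, r', ht, rfl⟩)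
    · rcases Trace.prefix_cat hx with ⟨h1, h2⟩ | ⟨r', -, rfl⟩
      · exact Or.inl (key x _ false (hw N) h1 h2)
      · exact Or.inr (Or.inr ⟨w, N, r', hw, hN, rfl⟩)
  postfix_closed := by
    rintro x y (⟨t, r, ht, e⟩ | ⟨w, N, r, hw, hN, e⟩) <;>
      simp only [Trace.cat, Trace.mk.injEq] at e
    · exact Or.inl ⟨t, ⟨r.events ++ y.events, y.tick⟩, ht, by simp [Trace.cat, e.1]⟩
    · exact Or.inr ⟨w, N, ⟨r.events ++ y.events, y.tick⟩, hw, hN, by simp [Trace.cat, e.1]⟩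

/-- The divergences of a renaming. -/
def renameD (P : Denot Evt) (R : Evt → Evt → Prop) : Set (Trace Evt) :=
  {x | ∃ (s t : List Evt) (r : Trace Evt), ⟨s, false⟩ ∈ P.D ∧ List.Forall₂ R s t ∧
    x = Trace.cat t r}

/-- Renaming. -/
def rename (P : Denot Evt) (R : Evt → Evt → Prop) : Denot Evt where
  T := {x | ∃ s ∈ P.T, Trace.Rel R s x} ∪ renameD P R
  D := renameD P R
  sub := Set.subset_union_right
  tick_mem := by
    rintro x ⟨s, t, r, hs, h, e⟩
    simp only [Trace.cat, Trace.mk.injEq] at e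
    exact ⟨s, t, ⟨r.events, false⟩, hs, h, by simp [Trace.cat, e.1]⟩
  nonempty := ⟨⟨[], false⟩, Or.inl ⟨_, P.nil_mem, .nil, rfl⟩⟩
  prefix_closed := by
    have key : ∀ (x : Trace Evt) (s t : List Evt) (b : Bool), ⟨s, b⟩ ∈ P.T →
        List.Forall₂ R s t → x.tick = false → x.events <+: t →
        ∃ s ∈ P.T, Trace.Rel R s x := by
      intro x s t b hs h h1 h2
      obtain ⟨y, hy, e⟩ := Trace.prefix_forall₂ h h2
      exact ⟨⟨y, false⟩, P.list_prefix_mem hy hs, e, h1.symm⟩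
    rintro x y hx (⟨s, hs, h⟩ | ⟨s, t, r, hs, h, rfl⟩)
    · rcases hx with rfl | ⟨h1, h2⟩
      · exact Or.inl ⟨s, hs, h⟩
      · exact Or.inl (key x _ _ s.tick hs h.1 h1 h2)
    · rcases Trace.prefix_cat hx with ⟨h1, h2⟩ | ⟨r', -, rfl⟩
      · exact Or.inl (key x s t false (P.sub hs) h h1 h2)
      · exact Or.inr ⟨s, t, r', hs, h, rfl⟩
  postfix_closed := by
    rintro x y ⟨s, t, r, hs, h, e⟩
    simp only [Trace.cat, Trace.mk.injEq] at e
    exact ⟨s, t, ⟨r.events ++ y.events, y.tick⟩, hs, h, by simp [Trace.cat, e.1]⟩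

/-! ### Monotonicity of the operators -/

theorem pre_mono (a : Evt) {P P' : Denot Evt} (h : P ≤ P') : pre a P ≤ pre a P' :=
  ⟨Set.union_subset_union_right _ fun _ ⟨s, hs, e⟩ => ⟨s, h.1 hs, e⟩,
    fun _ ⟨s, hs, e⟩ => ⟨s, h.2 hs, e⟩⟩

theorem choice_mono {P P' Q Q' : Denot Evt} (h : P ≤ P') (k : Q ≤ Q') :
    choice P Q ≤ choice P' Q' :=
  ⟨Set.union_subset_union h.1 k.1, Set.union_subset_union h.2 k.2⟩

theorem seq_mono {P P' Q Q' : Denot Evt} (h : P ≤ P') (k : Q ≤ Q') :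
    seq P Q ≤ seq P' Q' := by
  have hD : seqD P' Q' ⊆ seqD P Q := Set.union_subset_union h.2
    fun _ ⟨t, s, ht, hs, e⟩ => ⟨t, s, h.1 ht, k.2 hs, e⟩
  exact ⟨Set.union_subset_union (Set.union_subset_union (fun _ hx => ⟨h.1 hx.1, hx.2⟩)
    fun _ ⟨t, s, ht, hs, e⟩ => ⟨t, s, h.1 ht, k.1 hs, e⟩) hD, hD⟩

theorem par_mono (A : Set Evt) {P P' Q Q' : Denot Evt} (h : P ≤ P') (k : Q ≤ Q') :
    par A P Q ≤ par A P' Q' := by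
  have hD : parD A P' Q' ⊆ parD A P Q := fun _ ⟨s, t, w, r, hs, ht, hi, hd, e⟩ =>
    ⟨s, t, w, r, h.1 hs, k.1 ht, hi, hd.imp (fun x => h.2 x) (fun x => k.2 x), e⟩
  exact ⟨Set.union_subset_union (fun _ ⟨s, hs, t, ht, hi⟩ => ⟨s, h.1 hs, t, k.1 ht, hi⟩) hD, hD⟩

theorem hide_mono (A : Set Evt) {P P' : Denot Evt} (h : P ≤ P') : hide P A ≤ hide P' A := by
  have hD : hideD P' A ⊆ hideD P A := Set.union_subset_union
    (fun _ ⟨t, r, ht, e⟩ => ⟨t, r, h.2 ht, e⟩)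
    (fun _ ⟨w, N, r, hw, hN, e⟩ => ⟨w, N, r, fun i => h.1 (hw i), hN, e⟩)
  exact ⟨Set.union_subset_union (fun _ ⟨t, ht, e⟩ => ⟨t, h.1 ht, e⟩) hD, hD⟩

theorem rename_mono (R : Evt → Evt → Prop) {P P' : Denot Evt} (h : P ≤ P') :
    rename P R ≤ rename P' R := by
  have hD : renameD P' R ⊆ renameD P R :=
    fun _ ⟨s, t, r, hs, ht, e⟩ => ⟨s, t, r, h.2 hs, ht, e⟩
  exact ⟨Set.union_subset_union (fun _ ⟨s, hs, e⟩ => ⟨s, h.1 hs, e⟩) hD, hD⟩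

/-! ### The metrics -/

/-- The divergence component of the restriction of `P` to `U`-length `n`. -/
def restrictD (P : Denot Evt) (U : Set Evt) (n : ℕ) : Set (Trace Evt) :=
  P.D ∪ {x | ∃ (s : List Evt) (t : Trace Evt), ⟨s, false⟩ ∈ P.T ∧
    Trace.length U ⟨s, false⟩ = n ∧ x = Trace.cat s t}

/-- The restriction of `P` to `U`-length `n`, as a pair (traces, divergences): it behaves like `P`
until `n` events from `U` have occurred, after which it diverges unless it has terminated. -/
def restrict (P : Denot Evt) (U : Set Evt) (n : ℕ) : Set (Trace Evt) × Set (Trace Evt) :=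
  (restrictD P U n ∪ {s | s ∈ P.T ∧ Trace.length U s ≤ n}, restrictD P U n)

/-- The metric `d_U`. The set is never empty, as all restrictions to `U`-length `0` agree, and
is contained in `[0, 1]`. -/
noncomputable def dist (U : Set Evt) (P Q : Denot Evt) : ℝ :=
  sInf {x : ℝ | ∃ n : ℕ, P.restrict U n = Q.restrict U n ∧ x = (2 ^ n)⁻¹}

end Denot

/-! ### Denotation of terms -/

/-- The denotation of a term as a monotone function of the values of the variables. Recursion is
interpreted as the least fixed point in the refinement order. -/
noncomputable def Term.eval {Evt : Type u} {Var : Type v} [DecidableEq Var] :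
    Term Evt Var → ((Var → Denot Evt) →o Denot Evt)
  | .deadlock => OrderHom.const _ Denot.deadlock
  | .pre a P => ⟨fun ρ => Denot.pre a (P.eval ρ), fun _ _ h =>
      Denot.pre_mono a (P.eval.monotone h)⟩
  | .skip => OrderHom.const _ Denot.skip
  | .intChoice P Q => ⟨fun ρ => Denot.choice (P.eval ρ) (Q.eval ρ), fun _ _ h =>
      Denot.choice_mono (P.eval.monotone h) (Q.eval.monotone h)⟩
  | .extChoice P Q => ⟨fun ρ => Denot.choice (P.eval ρ) (Q.eval ρ), fun _ _ h =>
      Denot.choice_mono (P.eval.monotone h) (Q.eval.monotone h)⟩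
  | .par A P Q => ⟨fun ρ => Denot.par A (P.eval ρ) (Q.eval ρ), fun _ _ h =>
      Denot.par_mono A (P.eval.monotone h) (Q.eval.monotone h)⟩
  | .seq P Q => ⟨fun ρ => Denot.seq (P.eval ρ) (Q.eval ρ), fun _ _ h =>
      Denot.seq_mono (P.eval.monotone h) (Q.eval.monotone h)⟩
  | .hide P A => ⟨fun ρ => Denot.hide (P.eval ρ) A, fun _ _ h =>
      Denot.hide_mono A (P.eval.monotone h)⟩
  | .rename P R => ⟨fun ρ => Denot.rename (P.eval ρ) R, fun _ _ h =>
      Denot.rename_mono R (P.eval.monotone h)⟩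
  | .var X => ⟨fun ρ => ρ X, fun _ _ h => h X⟩
  | .mu X P => ⟨fun ρ => OrderHom.lfp ⟨fun x => P.eval (Function.update ρ X x), fun _ _ h =>
        P.eval.monotone (update_le_update_iff.2 ⟨h, fun _ _ => le_rfl⟩)⟩,
      fun _ _ h => OrderHom.lfp.monotone fun _ =>
        P.eval.monotone (update_le_update_iff.2 ⟨le_rfl, fun Y _ => h Y⟩)⟩
  | .div => OrderHom.const _ Denot.div

/-! ### The static analysis -/

/-- The image `R(U)` of a set of events under a renaming relation. -/
def relImage {Evt : Type u} (R : Evt → Evt → Prop) (U : Set Evt) : Set Evt :=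
  {y | ∃ x ∈ U, R x y}

/-- The nonexpansive sets `N_X(P)`; everything when `X` is not free in `P`. -/
def nonexp {Evt : Type u} {Var : Type v} [DecidableEq Var] :
    Term Evt Var → Var → Set (Set Evt × Set Evt)
  | .deadlock, _ => Set.univ
  | .skip, _ => Set.univ
  | .div, _ => Set.univ
  | .pre a P, X => if X ∉ (Term.pre a P).freeVars then Set.univ else nonexp P X
  | .intChoice P Q, X =>
      if X ∉ (Term.intChoice P Q).freeVars then Set.univ else nonexp P X ∩ nonexp Q X
  | .extChoice P Q, X =>
      if X ∉ (Term.extChoice P Q).freeVars then Set.univ else nonexp P X ∩ nonexp Q X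
  | .par A P Q, X =>
      if X ∉ (Term.par A P Q).freeVars then Set.univ else nonexp P X ∩ nonexp Q X
  | .seq P Q, X =>
      if X ∉ (Term.seq P Q).freeVars then Set.univ else nonexp P X ∩ nonexp Q X
  | .hide P A, X =>
      if X ∉ (Term.hide P A).freeVars then Set.univ else
        {p | ∃ V', (p.1, V') ∈ nonexp P X ∧ V' ∩ A = ∅ ∧ V' ⊆ p.2}
  | .rename P R, X =>
      if X ∉ (Term.rename P R).freeVars then Set.univ else
        {p | ∃ V', (p.1, V') ∈ nonexp P X ∧ relImage R V' ⊆ p.2}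
  | .var Y, X => if X ∉ (Term.var (Evt := Evt) Y).freeVars then Set.univ else {p | p.1 ⊆ p.2}
  | .mu Y P, X =>
      if X ∉ (Term.mu Y P).freeVars then Set.univ else
        {p | ∃ U' V', (U', V') ∈ nonexp P X ∧ (V', V') ∈ nonexp P Y ∧ p.1 ⊆ U' ∧ V' ⊆ p.2}

mutual

/-- The guard sets `G(P)`. No rule produces a guard set of the divergent process. -/
def guards {Evt : Type u} {Var : Type v} [DecidableEq Var] : Term Evt Var → Set (Set Evt)
  | .deadlock => Set.univ
  | .pre a P => guards P ∪ {V | a ∈ V}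
  | .skip => ∅
  | .intChoice P Q => guards P ∩ guards Q
  | .extChoice P Q => guards P ∩ guards Q
  | .seq P Q =>
      {V | (P.Closed ∧ (fair P).Nonempty ∧ V ∈ guards P ∪ guards Q) ∨
        (¬ (P.Closed ∧ (fair P).Nonempty) ∧ V ∈ guards P)}
  | .par _ P Q =>
      {V | (P.Closed ∧ (fair P).Nonempty ∧ Q.Closed ∧ (fair Q).Nonempty ∧
          V ∈ guards P ∪ guards Q) ∨
        (¬ (P.Closed ∧ (fair P).Nonempty ∧ Q.Closed ∧ (fair Q).Nonempty) ∧
          V ∈ guards P ∩ guards Q)}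
  | .hide P A =>
      {V | P.Closed ∧ (∅, Aᶜ) ∈ fair P ∧ ∃ V' ∈ guards P, V' ∩ A = ∅ ∧ V' ⊆ V}
  | .rename P R => {V | ∃ V' ∈ guards P, relImage R V' ⊆ V}
  | .var _ => ∅
  | .mu _ P => guards P
  | .div => ∅

/-- The contractive sets `C_X(P)`; everything when `X` is not free in `P`. -/
def contr {Evt : Type u} {Var : Type v} [DecidableEq Var] :
    Term Evt Var → Var → Set (Set Evt × Set Evt)
  | .deadlock, _ => Set.univ
  | .skip, _ => Set.univ
  | .div, _ => Set.univ
  | .pre a P, X =>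
      if X ∉ (Term.pre a P).freeVars then Set.univ else
        contr P X ∪ {p | p ∈ nonexp P X ∧ a ∈ p.2}
  | .intChoice P Q, X =>
      if X ∉ (Term.intChoice P Q).freeVars then Set.univ else contr P X ∩ contr Q X
  | .extChoice P Q, X =>
      if X ∉ (Term.extChoice P Q).freeVars then Set.univ else contr P X ∩ contr Q X
  | .par A P Q, X =>
      if X ∉ (Term.par A P Q).freeVars then Set.univ else contr P X ∩ contr Q X
  | .seq P Q, X =>
      if X ∉ (Term.seq P Q).freeVars then Set.univ else
        contr P X ∩ (contr Q X ∪ {p | p ∈ nonexp Q X ∧ p.2 ∈ guards P})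
  | .hide P A, X =>
      if X ∉ (Term.hide P A).freeVars then Set.univ else
        {p | ∃ V', (p.1, V') ∈ contr P X ∧ V' ∩ A = ∅ ∧ V' ⊆ p.2}
  | .rename P R, X =>
      if X ∉ (Term.rename P R).freeVars then Set.univ else
        {p | ∃ V', (p.1, V') ∈ contr P X ∧ relImage R V' ⊆ p.2}
  | .var Y, X => if X ∉ (Term.var (Evt := Evt) Y).freeVars then Set.univ else ∅
  | .mu Y P, X =>
      if X ∉ (Term.mu Y P).freeVars then Set.univ else
        {p | ∃ U' V', (U', V') ∈ contr P X ∧ (V', V') ∈ nonexp P Y ∧ p.1 ⊆ U' ∧ V' ⊆ p.2}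

/-- The fair sets `F(P)`. No rule produces a fair set of the divergent process. -/
def fair {Evt : Type u} {Var : Type v} [DecidableEq Var] :
    Term Evt Var → Set (Set Evt × Set Evt)
  | .deadlock => Set.univ
  | .pre _ P => fair P
  | .skip => Set.univ
  | .intChoice P Q => fair P ∩ fair Q
  | .extChoice P Q => fair P ∩ fair Q
  | .seq P Q => fair P ∩ fair Q
  | .par A P Q =>
      (fair P ∩ fair Q) ∪
        {p | ∃ U₁ U₂ V₁, (U₁, V₁) ∈ fair P ∧ (U₂, A) ∈ fair Q ∧ p = (U₁ ∩ U₂, V₁)} ∪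
        {p | ∃ U₁ U₂ V₂, (U₂, V₂) ∈ fair Q ∧ (U₁, A) ∈ fair P ∧ p = (U₁ ∩ U₂, V₂)}
  | .hide P A => {p | ∃ V', (p.1, V') ∈ fair P ∧ V' ∩ A = ∅ ∧ V' ⊆ p.2}
  | .rename P R => {p | ∃ V', (p.1, V') ∈ fair P ∧ relImage R V' ⊆ p.2}
  | .var _ => {p | p.1 ⊆ p.2}
  | .mu X P =>
      {p | ∃ W, (W, W) ∈ contr P X ∧ (W, W) ∈ fair P ∧
        (¬ (Term.mu X P).Closed → p.1 ⊆ W) ∧ W ⊆ p.2}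
  | .div => ∅

end

end CSP

-- Equality of two restrictions splits into two one-sided relations. `ApproxLE U n p q` says that
-- every trace or divergence of `q` is one of `p`, unless a prefix of it is a trace of `p` with at
-- least `n` events from `U`; by then the restriction of `p` has diverged, and anything is allowed.
-- The relation is reflexive and transitive, contains the refinement order, and is vacuous at `n =
-- 0`. The contraction claim becomes: precision `n` for `U` in the argument gives precision `n + 1`
-- for `V` in the result, in each direction separately (`restrict_eq_iff`, `dist_le_half_mul_dist`).
--
-- Each operator preserves precision, changing the event set as the rules for `N_X` prescribe. The
-- gain of one comes from a prefixed event in `V`, or from a first component of a sequential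
-- composition all of whose terminating traces contain an event from `V`. For recursion no
-- contraction in the bound variable is needed: the relation is closed under suprema on the left
-- (`ApproxLE.sSup_left`), so least fixed points are compared by fixed-point induction
-- (`ApproxLE.lfp`), and nonexpansiveness in the bound variable suffices.
--
-- The sets `C`, `G` and `F` refer to one another, so their meanings are proved in one structural
-- induction (`Term.sound`). `G` means `Guarded`. Divergence is catastrophic and so creates
-- terminating traces, which is why the rules for `G` appeal to `F`. `F` means `Fair`: no
-- divergence, and a bound on the length of traces in terms of their number of events from `V`.
-- Being a statement about finite traces, this passes to limits of approximations, hence to fixed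
-- points of contractions (`Fair.lfp`).

namespace CSP

open Function

-- Counting events along prefixes, hidings, renamings and interleavings

namespace Trace

variable {Evt : Type*} {U V A : Set Evt} {s t u x y : List Evt} {a : Evt}

open Classical in
/-- The number of occurrences in the sequence `s` of events from `U`. -/
noncomputable def count (U : Set Evt) (s : List Evt) : ℕ :=
  s.countP (fun a => decide (a ∈ U))

@[simp] theorem count_nil : count U ([] : List Evt) = 0 := rfl

theorem count_cons_of_mem (h : a ∈ U) : count U (a :: s) = count U s + 1 := by
  simp [count, h]

theorem count_cons_of_notMem (h : a ∉ U) : count U (a :: s) = count U s := by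
  simp [count, h]

@[simp] theorem count_append : count U (s ++ t) = count U s + count U t := by
  simp [count]

theorem count_le_length : count U s ≤ s.length := List.countP_le_length

theorem count_mono (h : U ⊆ V) : count U s ≤ count V s :=
  List.countP_mono_left fun _ _ hx => by simp only [decide_eq_true_eq] at hx ⊢; exact h hx

theorem count_le_of_prefix (h : s <+: t) : count U s ≤ count U t :=
  h.sublist.countP_le

/-- Cutting right after the `n`-th event from `U` gives a cut that depends on `s` alone, and so can
serve many processes at once. -/
theorem exists_least_prefix {n : ℕ} (h : n ≤ count U s) :
    ∃ t, t <+: s ∧ count U t = n ∧ ∀ u, u <+: s → n ≤ count U u → t <+: u := by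
  induction s generalizing n with
  | nil => exact ⟨[], List.prefix_rfl, by simp at h ⊢; omega, fun _ _ _ => List.nil_prefix⟩
  | cons a s ih =>
    cases n with
    | zero => exact ⟨[], List.nil_prefix, rfl, fun _ _ _ => List.nil_prefix⟩
    | succ n =>
      by_cases ha : a ∈ U
      · rw [count_cons_of_mem ha] at h
        obtain ⟨t, ht, e, hmin⟩ := ih (Nat.le_of_succ_le_succ h)
        refine ⟨a :: t, by simpa using ht, by rw [count_cons_of_mem ha, e], ?_⟩
        rintro (_ | ⟨c, u⟩) hu hn
        · simp at hn
        · obtain ⟨rfl, hu'⟩ := List.cons_prefix_cons.1 hu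
          rw [count_cons_of_mem ha] at hn
          simpa using hmin u hu' (Nat.le_of_succ_le_succ hn)
      · rw [count_cons_of_notMem ha] at h
        obtain ⟨t, ht, e, hmin⟩ := ih h
        refine ⟨a :: t, by simpa using ht, by rw [count_cons_of_notMem ha, e], ?_⟩
        rintro (_ | ⟨c, u⟩) hu hn
        · simp at hn
        · obtain ⟨rfl, hu'⟩ := List.cons_prefix_cons.1 hu
          rw [count_cons_of_notMem ha] at hn
          simpa using hmin u hu' hn

theorem hideList_append : hideList A (s ++ t) = hideList A s ++ hideList A t := by
  simp [hideList]

theorem hideList_eq_nil (h : ∀ a ∈ s, a ∈ A) : hideList A s = [] := by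
  simpa [hideList] using h

theorem hideList_prefix (h : s <+: t) : hideList A s <+: hideList A t := by
  obtain ⟨r, rfl⟩ := h
  exact ⟨_, hideList_append.symm⟩

theorem length_hideList_le : (hideList A s).length ≤ s.length := List.length_filter_le _ _

theorem count_hideList (h : V ∩ A = ∅) : count V (hideList A s) = count V s := by
  have hA : ∀ a ∈ V, a ∉ A := fun a hV hA => (h ▸ ⟨hV, hA⟩ : a ∈ (∅ : Set Evt))
  induction s with
  | nil => rfl
  | cons a s ih =>
    by_cases ha : a ∈ A
    · have e : hideList A (a :: s) = hideList A s := by simp [hideList, ha]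
      rw [e, ih, count_cons_of_notMem fun hV => hA a hV ha]
    · have e : hideList A (a :: s) = a :: hideList A s := by simp [hideList, ha]
      by_cases hV : a ∈ V
      · rw [e, count_cons_of_mem hV, count_cons_of_mem hV, ih]
      · rw [e, count_cons_of_notMem hV, count_cons_of_notMem hV, ih]

theorem count_le_of_forall₂ {R : Evt → Evt → Prop} (h : List.Forall₂ R s t)
    (hR : relImage R U ⊆ V) : count U s ≤ count V t := by
  induction h with
  | nil => exact le_rfl
  | @cons a b s t hab _ ih =>
    by_cases ha : a ∈ U
    · rw [count_cons_of_mem ha, count_cons_of_mem (hR ⟨a, ha, hab⟩)]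
      omega
    · rw [count_cons_of_notMem ha]
      exact ih.trans (List.sublist_cons_self b t).countP_le

theorem exists_prefix_forall₂ {R : Evt → Evt → Prop} (h : List.Forall₂ R s t) (hx : x <+: s) :
    ∃ y, y <+: t ∧ List.Forall₂ R x y := by
  obtain ⟨y, hy, hyx⟩ := prefix_forall₂ (R := flip R) h.flip hx
  exact ⟨y, hy, hyx.flip⟩

namespace Interleave

theorem symm (h : Interleave A s t u) : Interleave A t s u := by
  induction h with
  | nil => exact .nil
  | sync ha _ ih => exact .sync ha ih
  | left hb _ ih => exact .right hb ih
  | right hb _ ih => exact .left hb ih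

theorem sublist_left (h : Interleave A s t u) : s.Sublist u := by
  induction h with
  | nil => exact .slnil
  | sync _ _ ih => exact ih.cons_cons _
  | left _ _ ih => exact ih.cons_cons _
  | right _ _ ih => exact ih.cons _

theorem count_left_le (h : Interleave A s t u) : count U s ≤ count U u :=
  h.sublist_left.countP_le

theorem count_right_le (h : Interleave A s t u) : count U t ≤ count U u :=
  h.symm.count_left_le

/-- Every event of `A` in `t` is shared with `s`. This carries a bound on one component over to the
other in `Fair.par_of_left`. -/
theorem count_sync_le (h : Interleave A s t u) : count A t ≤ count A s := by
  induction h with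
  | nil => exact le_rfl
  | sync ha _ ih => rw [count_cons_of_mem ha, count_cons_of_mem ha]; omega
  | left hb _ ih => rwa [count_cons_of_notMem hb]
  | right hb _ ih => rwa [count_cons_of_notMem hb]

theorem length_le (h : Interleave A s t u) : u.length ≤ s.length + t.length := by
  induction h with
  | nil => simp
  | sync _ _ ih => simp only [List.length_cons]; omega
  | left _ _ ih => simp only [List.length_cons]; omega
  | right _ _ ih => simp only [List.length_cons]; omega

/-- Stopping the interleaving as soon as `x` has been consumed leaves prefixes of the partner and of
the result. -/
theorem exists_prefix_left (h : Interleave A s t u) (hx : x <+: s) :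
    ∃ t' u', t' <+: t ∧ u' <+: u ∧ Interleave A x t' u' := by
  induction h generalizing x with
  | nil => exact ⟨[], [], List.prefix_rfl, List.prefix_rfl, by simp_all [Interleave.nil]⟩
  | sync ha _ ih =>
    cases x with
    | nil => exact ⟨[], [], List.nil_prefix, List.nil_prefix, .nil⟩
    | cons c x =>
      obtain ⟨rfl, hx₂⟩ := List.cons_prefix_cons.1 hx
      obtain ⟨t', u', ht, hu, hi⟩ := ih hx₂
      exact ⟨c :: t', c :: u', by simpa using ht, by simpa using hu, .sync ha hi⟩
  | left hb _ ih =>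
    cases x with
    | nil => exact ⟨[], [], List.nil_prefix, List.nil_prefix, .nil⟩
    | cons c x =>
      obtain ⟨rfl, hx₂⟩ := List.cons_prefix_cons.1 hx
      obtain ⟨t', u', ht, hu, hi⟩ := ih hx₂
      exact ⟨t', c :: u', ht, by simpa using hu, .left hb hi⟩
  | @right b _ _ _ hb _ ih =>
    obtain ⟨t', u', ht, hu, hi⟩ := ih hx
    exact ⟨b :: t', b :: u', by simpa using ht, by simpa using hu, .right hb hi⟩

end Interleave

theorem Par.symm {s t x : Trace Evt} (h : Par A s t x) : Par A t s x :=
  ⟨h.1.symm, h.2.2, h.2.1⟩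

theorem initSeg_prefix (w : ℕ → Evt) {j k : ℕ} (h : j ≤ k) : initSeg w j <+: initSeg w k := by
  obtain ⟨m, rfl⟩ := Nat.exists_eq_add_of_le h
  refine ⟨((List.range m).map (j + ·)).map w, ?_⟩
  simp [initSeg, List.range_add]

theorem hideList_initSeg {w : ℕ → Evt} {N k : ℕ} (hN : ∀ i, N ≤ i → w i ∈ A) (h : N ≤ k) :
    hideList A (initSeg w k) = hideList A (initSeg w N) := by
  obtain ⟨m, rfl⟩ := Nat.exists_eq_add_of_le h
  have e : initSeg w (N + m) = initSeg w N ++ ((List.range m).map (N + ·)).map w := by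
    simp [initSeg, List.range_add]
  rw [e, hideList_append, hideList_eq_nil (s := ((List.range m).map (N + ·)).map w),
    List.append_nil]
  simp only [List.mem_map]
  rintro _ ⟨_, ⟨i, -, rfl⟩, rfl⟩
  exact hN _ (Nat.le_add_right _ _)

@[simp] theorem length_initSeg (w : ℕ → Evt) (k : ℕ) : (initSeg w k).length = k := by
  simp [initSeg]

end Trace

-- One-sided approximation up to a number of events

namespace Denot

open Trace

variable {Evt : Type*} {U V A : Set Evt} {n m : ℕ} {p p' q q' r : Denot Evt}

/-- Some prefix of `x` is a trace of `p` containing at least `n` events from `U`. -/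
def Exceeds (p : Denot Evt) (U : Set Evt) (n : ℕ) (x : List Evt) : Prop :=
  ∃ s, s <+: x ∧ ⟨s, false⟩ ∈ p.T ∧ n ≤ count U s

/-- `q` refines `p` up to `U`-length `n`: the restriction of `p` to `U`-length `n` lies below
the one of `q` in the refinement order. -/
structure ApproxLE (U : Set Evt) (n : ℕ) (p q : Denot Evt) : Prop where
  traces : ∀ x ∈ q.T, x ∈ p.T ∨ p.Exceeds U n x.events
  divs : ∀ x ∈ q.D, x ∈ p.D ∨ p.Exceeds U n x.events

theorem Exceeds.extend {s x : List Evt} (h : p.Exceeds U n s) (hs : s <+: x) :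
    p.Exceeds U n x :=
  let ⟨t, ht, hp, hn⟩ := h
  ⟨t, ht.trans hs, hp, hn⟩

theorem Exceeds.le_count {x : List Evt} (h : p.Exceeds U n x) : n ≤ count U x :=
  let ⟨_, ht, _, hn⟩ := h
  hn.trans (count_le_of_prefix ht)

/-- The witnessing trace of `q` either belongs to `p`, or already extends a witness for `p`. This is
what makes `ApproxLE` transitive. -/
theorem Exceeds.approx {x : List Evt} (h : q.Exceeds U n x) (hpq : ApproxLE U n p q) :
    p.Exceeds U n x := by
  obtain ⟨s, hs, hq, hn⟩ := h
  rcases hpq.traces _ hq with hp | hp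
  · exact ⟨s, hs, hp, hn⟩
  · exact hp.extend hs

namespace ApproxLE

theorem of_le (h : p ≤ q) : ApproxLE U n p q :=
  ⟨fun _ hx => .inl (h.1 hx), fun _ hx => .inl (h.2 hx)⟩

theorem refl (p : Denot Evt) : ApproxLE U n p p := of_le le_rfl

theorem trans (h : ApproxLE U n p q) (k : ApproxLE U n q r) : ApproxLE U n p r :=
  ⟨fun x hx => (k.traces x hx).elim (h.traces x) fun e => .inr (e.approx h),
    fun x hx => (k.divs x hx).elim (h.divs x) fun e => .inr (e.approx h)⟩

theorem zero (p q : Denot Evt) : ApproxLE U 0 p q :=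
  ⟨fun _ _ => .inr ⟨[], List.nil_prefix, p.nil_mem, Nat.zero_le _⟩,
    fun _ _ => .inr ⟨[], List.nil_prefix, p.nil_mem, Nat.zero_le _⟩⟩

theorem mono (h : ApproxLE U n p q) (hU : U ⊆ V) : ApproxLE V n p q := by
  have key : ∀ x, p.Exceeds U n x → p.Exceeds V n x := fun x ⟨s, hs, hp, hn⟩ =>
    ⟨s, hs, hp, hn.trans (count_mono hU)⟩
  exact ⟨fun x hx => (h.traces x hx).imp_right (key _),
    fun x hx => (h.divs x hx).imp_right (key _)⟩

/-- Suprema are intersections, so a single witness must be a trace of all members of `S`. The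
shortest prefix of `x` with `n` events from `U` is below the witness of each member, and prefix
closure puts it into all of them. If `x` has fewer than `n` such events, no member can use the
escape clause. -/
theorem sSup_left {S : Set (Denot Evt)} (h : ∀ p ∈ S, ApproxLE U n p q) :
    ApproxLE U n (sSup S) q := by
  have key : ∀ x : Trace Evt, n ≤ count U x.events →
      (∀ p ∈ S, x ∈ p.T ∨ p.Exceeds U n x.events) → (sSup S).Exceeds U n x.events := by
    intro x hn hx
    obtain ⟨s, hs, e, hmin⟩ := exists_least_prefix hn
    refine ⟨s, hs, fun p hp => ?_, e.ge⟩
    rcases hx p hp with hp' | ⟨t, ht, hp', hn'⟩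
    · exact p.list_prefix_mem hs hp'
    · exact p.list_prefix_mem (hmin t ht hn') hp'
  refine ⟨fun x hx => ?_, fun x hx => ?_⟩
  · by_cases hn : n ≤ count U x.events
    · exact .inr (key x hn fun p hp => (h p hp).traces x hx)
    · exact .inl fun p hp => ((h p hp).traces x hx).resolve_right fun e => hn e.le_count
  · by_cases hn : n ≤ count U x.events
    · exact .inr (key x hn fun p hp => ((h p hp).divs x hx).imp_left fun e => p.sub e)
    · exact .inl fun p hp => ((h p hp).divs x hx).resolve_right fun e => hn e.le_count

end ApproxLE

-- The operators and least fixed points preserve approximation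

namespace ApproxLE

theorem pre {a : Evt} (h : ApproxLE V n p q) (hm : m ≤ n + count V [a]) :
    ApproxLE V m (Denot.pre a p) (Denot.pre a q) := by
  have key : ∀ x : List Evt, p.Exceeds V n x → (Denot.pre a p).Exceeds V m ([a] ++ x) := by
    rintro x ⟨s, hs, hp, hn⟩
    exact ⟨[a] ++ s, (List.prefix_append_right_inj _).2 hs, .inr ⟨_, hp, rfl⟩,
      by rw [count_append]; omega⟩
  constructor
  · rintro _ (rfl | ⟨s, hs, rfl⟩)
    · exact .inl (.inl rfl)
    · exact (h.traces s hs).imp (fun e => .inr ⟨s, e, rfl⟩) (key _)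
  · rintro _ ⟨s, hs, rfl⟩
    exact (h.divs s hs).imp (fun e => ⟨s, e, rfl⟩) (key _)

theorem choice (h : ApproxLE V n p q) (k : ApproxLE V n p' q') :
    ApproxLE V n (Denot.choice p p') (Denot.choice q q') := by
  have key₁ : ∀ x : List Evt, p.Exceeds V n x → (Denot.choice p p').Exceeds V n x :=
    fun x ⟨s, hs, hp, hn⟩ => ⟨s, hs, .inl hp, hn⟩
  have key₂ : ∀ x : List Evt, p'.Exceeds V n x → (Denot.choice p p').Exceeds V n x :=
    fun x ⟨s, hs, hp, hn⟩ => ⟨s, hs, .inr hp, hn⟩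
  constructor
  · rintro x (hx | hx)
    · exact (h.traces x hx).imp .inl (key₁ _)
    · exact (k.traces x hx).imp .inr (key₂ _)
  · rintro x (hx | hx)
    · exact (h.divs x hx).imp .inl (key₁ _)
    · exact (k.divs x hx).imp .inr (key₂ _)

theorem seq_left (h : ApproxLE V n p p') : ApproxLE V n (seq p q) (seq p' q) := by
  have key : ∀ x : List Evt, p.Exceeds V n x → (Denot.seq p q).Exceeds V n x :=
    fun x ⟨s, hs, hp, hn⟩ => ⟨s, hs, .inl (.inl ⟨hp, rfl⟩), hn⟩
  have keyD : ∀ x ∈ seqD p' q, x ∈ seqD p q ∨ (Denot.seq p q).Exceeds V n x.events := by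
    rintro _ (hx | ⟨t, s, ht, hs, rfl⟩)
    · exact (h.divs _ hx).imp .inl (key _)
    · exact (h.traces _ ht).imp (fun e => .inr ⟨t, s, e, hs, rfl⟩)
        fun e => (key _ e).extend (List.prefix_append _ _)
  refine ⟨?_, keyD⟩
  rintro _ ((⟨hx, htick⟩ | ⟨t, s, ht, hs, rfl⟩) | hx)
  · exact (h.traces _ hx).imp (fun e => .inl (.inl ⟨e, htick⟩)) (key _)
  · exact (h.traces _ ht).imp (fun e => .inl (.inr ⟨t, s, e, hs, rfl⟩))
      fun e => (key _ e).extend (List.prefix_append _ _)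
  · exact (keyD _ hx).imp_left .inr

/-- The second component starts only after a terminating trace of the first, whose events from `V`
add to the precision. If `p` is guarded by `V`, then `m = n + 1` is admissible. -/
theorem seq_right (h : ApproxLE V n q q') (hm : ∀ t, ⟨t, true⟩ ∈ p.T → m ≤ n + count V t) :
    ApproxLE V m (seq p q) (seq p q') := by
  have key : ∀ t x : List Evt, ⟨t, true⟩ ∈ p.T → q.Exceeds V n x →
      (Denot.seq p q).Exceeds V m (t ++ x) := by
    rintro t x ht ⟨s, hs, hq, hn⟩
    refine ⟨t ++ s, (List.prefix_append_right_inj _).2 hs,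
      .inl (.inr ⟨t, _, ht, hq, rfl⟩), ?_⟩
    have := hm t ht
    rw [count_append]
    omega
  have keyD : ∀ x ∈ seqD p q', x ∈ seqD p q ∨ (Denot.seq p q).Exceeds V m x.events := by
    rintro _ (hx | ⟨t, s, ht, hs, rfl⟩)
    · exact .inl (.inl hx)
    · exact (h.divs _ hs).imp (fun e => .inr ⟨t, s, ht, e, rfl⟩) (key _ _ ht)
  refine ⟨?_, keyD⟩
  rintro _ ((hx | ⟨t, s, ht, hs, rfl⟩) | hx)
  · exact .inl (.inl (.inl hx))
  · exact (h.traces _ hs).imp (fun e => .inl (.inr ⟨t, s, ht, e, rfl⟩)) (key _ _ ht)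
  · exact (keyD _ hx).imp_left .inr

end ApproxLE

theorem par_comm (A : Set Evt) (p q : Denot Evt) : par A p q = par A q p := by
  have hD : ∀ p q : Denot Evt, parD A p q ⊆ parD A q p :=
    fun _ _ _ ⟨s, t, w, r, hs, ht, h, hd, e⟩ => ⟨t, s, w, r, ht, hs, h.symm, hd.symm, e⟩
  have hT : ∀ p q : Denot Evt, (par A p q).T ⊆ (par A q p).T := fun p q _ hx =>
    hx.imp (fun ⟨s, hs, t, ht, h⟩ => ⟨t, ht, s, hs, h.symm⟩) (@hD p q _)
  exact Denot.ext ((hT _ _).antisymm (hT _ _)) ((hD _ _).antisymm (hD _ _))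

theorem Exceeds.par {s t : List Evt} {w : List Evt} {b : Bool} (h : p.Exceeds V n s)
    (hi : Interleave A s t w) (ht : ⟨t, b⟩ ∈ q.T) : (par A p q).Exceeds V n w := by
  obtain ⟨s', hs', hp, hn⟩ := h
  obtain ⟨t', w', ht', hw', hi'⟩ := hi.exists_prefix_left hs'
  exact ⟨w', hw', .inl ⟨_, hp, _, q.list_prefix_mem ht' ht, hi', rfl, rfl⟩,
    hn.trans hi'.count_left_le⟩

namespace ApproxLE

/-- A prefix of `s` rich in events from `V` induces a prefix of the interleaving that is at least as
rich, since all events of `s` occur in it. -/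
theorem par_left (h : ApproxLE V n p p') : ApproxLE V n (par A p q) (par A p' q) := by
  have keyD : ∀ x ∈ parD A p' q, x ∈ parD A p q ∨ (Denot.par A p q).Exceeds V n x.events := by
    rintro _ ⟨s, t, w, r, hs, ht, hi, hd, rfl⟩
    have exceeds : p.Exceeds V n s.events → (Denot.par A p q).Exceeds V n (w ++ r.events) :=
      fun e => (e.par hi.1 ht).extend (List.prefix_append _ _)
    rcases h.traces s hs with hp | hp
    · rcases hd with hd | hd
      · exact (h.divs s hd).imp (fun e => ⟨s, t, w, r, hp, ht, hi, .inl e, rfl⟩) exceeds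
      · exact .inl ⟨s, t, w, r, hp, ht, hi, .inr hd, rfl⟩
    · exact .inr (exceeds hp)
  refine ⟨?_, keyD⟩
  rintro x (⟨s, hs, t, ht, hi⟩ | hx)
  · exact (h.traces s hs).imp (fun e => .inl ⟨s, e, t, ht, hi⟩) fun e => e.par hi.1 ht
  · exact (keyD _ hx).imp_left .inr

theorem par (h : ApproxLE V n p p') (k : ApproxLE V n q q') :
    ApproxLE V n (par A p q) (par A p' q') := by
  refine h.par_left.trans ?_
  rw [par_comm A p' q, par_comm A p' q']
  exact k.par_left

theorem hide {V' : Set Evt} (h : ApproxLE V' n p q) (hA : V' ∩ A = ∅) (hV : V' ⊆ V) :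
    ApproxLE V n (hide p A) (hide q A) := by
  have key : ∀ x : List Evt, p.Exceeds V' n x →
      (Denot.hide p A).Exceeds V n (hideList A x) := by
    rintro x ⟨s, hs, hp, hn⟩
    refine ⟨hideList A s, hideList_prefix hs, .inl ⟨_, hp, rfl⟩, hn.trans ?_⟩
    rw [← count_hideList hA]
    exact count_mono hV
  have keyD : ∀ x ∈ hideD q A, x ∈ hideD p A ∨ (Denot.hide p A).Exceeds V n x.events := by
    rintro _ (⟨t, r, ht, rfl⟩ | ⟨w, N, r, hw, hN, rfl⟩)
    · exact (h.divs _ ht).imp (fun e => .inl ⟨t, r, e, rfl⟩)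
        fun e => (key _ e).extend (List.prefix_append _ _)
    · by_cases hp : ∀ k, ⟨initSeg w k, false⟩ ∈ p.T
      · exact .inl (.inr ⟨w, N, r, hp, hN, rfl⟩)
      -- Some finite prefix of `w` is missing from `p`, so `p` has exceeded `n` within it.
      -- Lengthening that prefix to at least `N` keeps this true and makes its hiding equal to that
      -- of the first `N` events.
      · obtain ⟨k, hk⟩ := not_forall.1 hp
        have e := (h.traces _ (hw k)).resolve_left hk
        have e' := key _ (e.extend (initSeg_prefix w (le_max_left k N)))
        rw [hideList_initSeg hN (le_max_right k N)] at e'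
        exact .inr (e'.extend (List.prefix_append _ _))
  refine ⟨?_, keyD⟩
  rintro _ (⟨t, ht, rfl⟩ | hx)
  · exact (h.traces _ ht).imp (fun e => .inl ⟨t, e, rfl⟩) (key _)
  · exact (keyD _ hx).imp_left .inr

theorem rename {R : Evt → Evt → Prop} (h : ApproxLE U n p q) (hR : relImage R U ⊆ V) :
    ApproxLE V n (rename p R) (rename q R) := by
  have key : ∀ x y : List Evt, List.Forall₂ R x y → p.Exceeds U n x →
      (Denot.rename p R).Exceeds V n y := by
    rintro x y hxy ⟨s, hs, hp, hn⟩
    obtain ⟨t, ht, hst⟩ := exists_prefix_forall₂ hxy hs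
    exact ⟨t, ht, .inl ⟨_, hp, hst, rfl⟩, hn.trans (count_le_of_forall₂ hst hR)⟩
  have keyD : ∀ x ∈ renameD q R, x ∈ renameD p R ∨
      (Denot.rename p R).Exceeds V n x.events := by
    rintro _ ⟨s, t, r, hs, hst, rfl⟩
    exact (h.divs _ hs).imp (fun e => ⟨s, t, r, e, hst, rfl⟩)
      fun e => (key _ _ hst e).extend (List.prefix_append _ _)
  refine ⟨?_, keyD⟩
  rintro x (⟨s, hs, hst⟩ | hx)
  · exact (h.traces _ hs).imp (fun e => .inl ⟨s, e, hst⟩) (key _ _ hst.1)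
  · exact (keyD _ hx).imp_left .inr

/-- Fixed-point induction on `f`, with the fixed point of `g` held constant on the right: the
predicate is preserved by `f` because `g` fixes its right-hand side, and by suprema through
`sSup_left`. -/
theorem lfp {f g : Denot Evt →o Denot Evt}
    (h : ∀ x y, ApproxLE V n x y → ApproxLE V n (f x) (g y)) :
    ApproxLE V n (OrderHom.lfp f) (OrderHom.lfp g) := by
  refine OrderHom.lfp_induction f (p := fun x => ApproxLE V n x (OrderHom.lfp g)) ?_ ?_
  · intro x hx _
    rw [← OrderHom.map_lfp g]
    exact h _ _ hx
  · exact fun S hS => sSup_left hS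

end ApproxLE

/-! ### Restrictions and the metric -/

/-- The traces added by the restriction are the extensions of traces with exactly `n` events from
`U`. Having a prefix with at least `n` of them amounts to the same, since such a prefix can be cut
back at its `n`-th event. -/
theorem restrict_eq_iff : p.restrict U n = q.restrict U n ↔
    ApproxLE U n p q ∧ ApproxLE U n q p := by
  have mp : ∀ p q : Denot Evt, p.restrict U n = q.restrict U n → ApproxLE U n p q := by
    intro p q h
    have hD : p.restrictD U n = q.restrictD U n := congrArg Prod.snd h
    have exceeds : ∀ x ∈ p.restrictD U n, x ∈ p.D ∨ p.Exceeds U n x.events := by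
      rintro _ (hx | ⟨s, t, hs, e, rfl⟩)
      · exact .inl hx
      · exact .inr ⟨s, List.prefix_append _ _, hs, e.ge⟩
    refine ⟨fun x hx => ?_, fun x hx => exceeds x (hD ▸ .inl hx)⟩
    by_cases hn : x.length U ≤ n
    · have : x ∈ (p.restrict U n).1 := h ▸ .inr ⟨hx, hn⟩
      rcases this with hx' | hx'
      · exact (exceeds x hx').imp_left fun e => p.sub e
      · exact .inl hx'.1
    -- A trace with more than `n` events extends one with exactly `n`, so it is a divergence of the
    -- restriction of `q`, hence of that of `p`.
    · obtain ⟨s, ⟨t, e⟩, hs, -⟩ := exists_least_prefix (not_le.1 hn).le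
      have hq : (⟨s, false⟩ : Trace Evt) ∈ q.T := q.list_prefix_mem ⟨t, e⟩ hx
      have : x ∈ q.restrictD U n := .inr ⟨s, ⟨t, x.tick⟩, hq, hs, Trace.ext e.symm rfl⟩
      exact (exceeds x (hD ▸ this)).imp_left fun e => p.sub e
  have mpr : ∀ p q : Denot Evt, ApproxLE U n p q →
      q.restrictD U n ⊆ p.restrictD U n ∧ (q.restrict U n).1 ⊆ (p.restrict U n).1 := by
    intro p q h
    have exceeds : ∀ x : Trace Evt, p.Exceeds U n x.events → x ∈ p.restrictD U n := by
      rintro ⟨x, b⟩ ⟨s, hs, hp, hn⟩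
      obtain ⟨t, ht, e, -⟩ := exists_least_prefix hn
      obtain ⟨r, rfl⟩ := ht.trans hs
      exact .inr ⟨t, ⟨r, b⟩, p.list_prefix_mem ht hp, e, rfl⟩
    have hD : q.restrictD U n ⊆ p.restrictD U n := by
      rintro x (hx | ⟨s, t, hs, e, rfl⟩)
      · exact (h.divs x hx).elim .inl (exceeds x)
      · exact exceeds _ (Exceeds.approx ⟨s, List.prefix_append _ _, hs, e.ge⟩ h)
    refine ⟨hD, ?_⟩
    rintro x (hx | ⟨hx, hn⟩)
    · exact .inl (hD hx)
    · exact (h.traces x hx).elim (fun e => .inr ⟨e, hn⟩) fun e => .inl (exceeds x e)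
  refine ⟨fun h => ⟨mp _ _ h, mp _ _ h.symm⟩, fun ⟨h, k⟩ => ?_⟩
  exact Prod.ext ((mpr _ _ k).2.antisymm (mpr _ _ h).2) ((mpr _ _ k).1.antisymm (mpr _ _ h).1)

theorem dist_le_half_mul_dist {f : Denot Evt → Denot Evt}
    (h : ∀ n p q, ApproxLE U n p q → ApproxLE V (n + 1) (f p) (f q)) (p q : Denot Evt) :
    dist V (f p) (f q) ≤ 1 / 2 * dist U p q := by
  suffices H : 2 * dist V (f p) (f q) ≤ dist U p q by linarith
  -- Precision `0` always holds, so the infimum is over a nonempty set and may be bounded below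
  -- elementwise.
  refine le_csInf ⟨_, 0, restrict_eq_iff.2 ⟨.zero _ _, .zero _ _⟩, rfl⟩ ?_
  rintro _ ⟨n, hn, rfl⟩
  obtain ⟨h₁, h₂⟩ := restrict_eq_iff.1 hn
  have hle : dist V (f p) (f q) ≤ (2 ^ (n + 1))⁻¹ :=
    csInf_le ⟨0, by rintro _ ⟨k, -, rfl⟩; positivity⟩
      ⟨n + 1, restrict_eq_iff.2 ⟨h _ _ _ h₁, h _ _ _ h₂⟩, rfl⟩
  calc 2 * dist V (f p) (f q) ≤ 2 * (2 ^ (n + 1))⁻¹ := by linarith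
    _ = (2 ^ n)⁻¹ := by rw [pow_succ, mul_inv]; ring

/-! ### Guardedness and uniform fairness -/

/-- Every terminating trace of `p` contains an event from `V`. -/
def Guarded (p : Denot Evt) (V : Set Evt) : Prop :=
  ∀ t, ⟨t, true⟩ ∈ p.T → 1 ≤ count V t

theorem count_le_of_eq_cat {x t : List Evt} {b : Bool} {s : Trace Evt}
    (h : (⟨x, b⟩ : Trace Evt) = cat t s) : count V t ≤ count V x := by
  obtain rfl : x = t ++ s.events := congrArg Trace.events h
  exact count_le_of_prefix (List.prefix_append _ _)

theorem Guarded.mono (h : p.Guarded U) (hU : U ⊆ V) : p.Guarded V :=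
  fun t ht => (h t ht).trans (count_mono hU)

/-- After a divergence anything may follow, in particular immediate termination. -/
theorem Guarded.count_pos_of_mem_D {t : List Evt} (h : p.Guarded V) (ht : ⟨t, false⟩ ∈ p.D) :
    1 ≤ count V t := by
  refine h t (p.sub ?_)
  simpa [cat] using p.postfix_closed t ⟨[], true⟩ ht

theorem guarded_pre {a : Evt} (h : p.Guarded V ∨ a ∈ V) : (pre a p).Guarded V := by
  rintro t (ht | ⟨⟨s, b⟩, hs, e⟩)
  · simp at ht
  · simp only [cat, Trace.mk.injEq] at e
    obtain ⟨rfl, rfl⟩ := e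
    rw [count_append]
    rcases h with h | h
    · exact (h s hs).trans (Nat.le_add_left _ _)
    · simp [count_cons_of_mem h]

theorem Guarded.choice (h : p.Guarded V) (k : q.Guarded V) : (choice p q).Guarded V :=
  fun t ht => ht.elim (h t) (k t)

theorem Guarded.seq_left (h : p.Guarded V) : (seq p q).Guarded V := by
  rintro x ((⟨-, hx⟩ | ⟨t, s, ht, -, e⟩) | (hx | ⟨t, s, ht, -, e⟩))
  · simp at hx
  · exact (h t ht).trans (count_le_of_eq_cat e)
  · exact h x (p.sub hx)
  · exact (h t ht).trans (count_le_of_eq_cat e)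

/-- Without divergences of `p`, termination can only come from `q`; a divergence of `p` could
terminate without reaching `q`. -/
theorem Guarded.seq_right (h : q.Guarded V) (hp : p.D = ∅) : (seq p q).Guarded V := by
  have key : ∀ x t (s : Trace Evt), s ∈ q.T → ⟨x, true⟩ = cat t s → 1 ≤ count V x := by
    rintro x t ⟨s, b⟩ hs e
    simp only [cat, Trace.mk.injEq] at e
    obtain ⟨rfl, rfl⟩ := e
    rw [count_append]
    exact (h s hs).trans (Nat.le_add_left _ _)
  rintro x ((⟨-, hx⟩ | ⟨t, s, -, hs, e⟩) | (hx | ⟨t, s, -, hs, e⟩))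
  · simp at hx
  · exact key x t s hs e
  · simp [hp] at hx
  · exact key x t s (q.sub hs) e

theorem Guarded.par_left_of_D_eq_empty (h : p.Guarded V) (hp : p.D = ∅) (hq : q.D = ∅) :
    (par A p q).Guarded V := by
  rintro x (⟨⟨s, b⟩, hs, t, -, hi, hb, -⟩ | ⟨s, t, w, r, -, -, -, hd, -⟩)
  · obtain rfl : b = true := hb
    exact (h s hs).trans hi.count_left_le
  · simp [hp, hq] at hd

/-- Divergence is harmless here: whichever component diverges is itself guarded, so its trace
already contains an event from `V`. -/
theorem Guarded.par (h : p.Guarded V) (k : q.Guarded V) : (par A p q).Guarded V := by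
  rintro x (⟨⟨s, b⟩, hs, t, -, hi, hb, -⟩ | ⟨⟨s, b⟩, ⟨t, c⟩, w, r, -, -, ⟨hi, hb, hc⟩, hd, e⟩)
  · obtain rfl : b = true := hb
    exact (h s hs).trans hi.count_left_le
  · obtain rfl : b = false := hb
    obtain rfl : c = false := hc
    have hw : count V w ≤ count V x := count_le_of_eq_cat e
    refine le_trans ?_ hw
    rcases hd with hd | hd
    · exact (h.count_pos_of_mem_D hd).trans hi.count_left_le
    · exact (k.count_pos_of_mem_D hd).trans hi.count_right_le

theorem Guarded.hide (h : p.Guarded V) (hA : V ∩ A = ∅) (hp : (hide p A).D = ∅) :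
    (hide p A).Guarded V := by
  rintro x (⟨⟨s, b⟩, hs, e⟩ | hx)
  · simp only [Trace.hide, Trace.mk.injEq] at e
    obtain ⟨rfl, rfl⟩ := e
    rw [count_hideList hA]
    exact h s hs
  · exact absurd hx (by change _ ∉ (Denot.hide p A).D; simp [hp])

theorem Guarded.rename {R : Evt → Evt → Prop} (h : p.Guarded U) (hR : relImage R U ⊆ V) :
    (rename p R).Guarded V := by
  rintro x (⟨⟨s, b⟩, hs, hst, hb⟩ | ⟨s, t, r, hs, hst, e⟩)
  · obtain rfl : b = true := hb
    exact (h s hs).trans (count_le_of_forall₂ hst hR)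
  · have hw : count V t ≤ count V x := count_le_of_eq_cat e
    exact ((h.count_pos_of_mem_D hs).trans (count_le_of_forall₂ hst hR)).trans hw

/-- `p` is divergence-free, and the traces of `p` with a bounded number of events from `V` have
bounded length. In particular every infinite trace of `p` contains infinitely many events
from `V`. -/
structure Fair (p : Denot Evt) (V : Set Evt) : Prop where
  D_eq_empty : p.D = ∅
  bounded : ∀ n, ∃ M, ∀ s, ⟨s, false⟩ ∈ p.T → count V s ≤ n → s.length ≤ M

namespace Fair

theorem mono (h : p.Fair U) (hU : U ⊆ V) : p.Fair V :=
  ⟨h.1, fun n => (h.2 n).imp fun _ hM s hs hn => hM s hs ((count_mono hU).trans hn)⟩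

theorem deadlock : (deadlock : Denot Evt).Fair V :=
  ⟨rfl, fun _ => ⟨0, by
    rintro s hs -
    obtain rfl : s = [] := congrArg Trace.events hs
    exact le_rfl⟩⟩

theorem skip : (skip : Denot Evt).Fair V :=
  ⟨rfl, fun _ => ⟨0, by
    rintro s (hs | hs) -
    all_goals
      obtain rfl : s = [] := congrArg Trace.events hs
      exact le_rfl⟩⟩

theorem pre {a : Evt} (h : p.Fair V) : (pre a p).Fair V := by
  refine ⟨?_, fun n => ?_⟩
  · simp [Denot.pre, h.1]
  · obtain ⟨M, hM⟩ := h.2 n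
    refine ⟨M + 1, ?_⟩
    rintro _ (hs | ⟨⟨s, b⟩, hs, e⟩) hn
    · obtain rfl := congrArg Trace.events hs
      exact Nat.zero_le _
    · simp only [cat, Trace.mk.injEq] at e
      obtain ⟨rfl, rfl⟩ := e
      rw [count_append] at hn
      have := hM s hs (by omega)
      simp only [List.length_append, List.length_singleton]
      omega

theorem choice (h : p.Fair V) (k : q.Fair V) : (choice p q).Fair V := by
  refine ⟨by simp [Denot.choice, h.1, k.1], fun n => ?_⟩
  obtain ⟨M, hM⟩ := h.2 n
  obtain ⟨N, hN⟩ := k.2 n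
  exact ⟨max M N, fun s hs hn => hs.elim (fun e => (hM s e hn).trans (le_max_left _ _))
    fun e => (hN s e hn).trans (le_max_right _ _)⟩

theorem seq (h : p.Fair V) (k : q.Fair V) : (seq p q).Fair V := by
  have hD : seqD p q = ∅ := by simp [seqD, h.1, k.1]
  refine ⟨hD, fun n => ?_⟩
  obtain ⟨M, hM⟩ := h.2 n
  obtain ⟨N, hN⟩ := k.2 n
  refine ⟨M + N, ?_⟩
  rintro x ((⟨hx, -⟩ | ⟨t, ⟨s, b⟩, ht, hs, e⟩) | hx) hn
  · exact (hM x hx hn).trans (Nat.le_add_right _ _)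
  · simp only [cat, Trace.mk.injEq] at e
    obtain ⟨rfl, rfl⟩ := e
    rw [count_append] at hn
    have h₁ := hM t (p.list_prefix_mem List.prefix_rfl ht) (by omega)
    have h₂ := hN s hs (by omega)
    rw [List.length_append]
    omega
  · simp [hD] at hx

theorem parD_eq_empty (h : p.Fair U) (k : q.Fair V) : parD A p q = ∅ := by
  simp [parD, h.1, k.1]

/-- Few events from `V` force the trace of `p` to be short. It then offers few synchronisations on
`A`, and fairness of `q` for `A` makes the trace of `q` short as well. -/
theorem par_of_left (h : p.Fair V) (k : q.Fair A) : (par A p q).Fair V := by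
  have hD : parD A p q = ∅ := h.parD_eq_empty k
  refine ⟨hD, fun n => ?_⟩
  obtain ⟨M, hM⟩ := h.2 n
  obtain ⟨N, hN⟩ := k.2 M
  refine ⟨M + N, ?_⟩
  rintro x (⟨⟨s, b⟩, hs, ⟨t, c⟩, ht, hi, hb, hc⟩ | hx) hn
  · obtain rfl : b = false := hb
    obtain rfl : c = false := hc
    have h₁ := hM s hs (hi.count_left_le.trans hn)
    have h₂ := hN t ht (hi.count_sync_le.trans (count_le_length.trans h₁))
    exact hi.length_le.trans (Nat.add_le_add h₁ h₂)
  · simp [hD] at hx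

theorem par (h : p.Fair V) (k : q.Fair V) : (par A p q).Fair V := by
  have hD : parD A p q = ∅ := h.parD_eq_empty k
  refine ⟨hD, fun n => ?_⟩
  obtain ⟨M, hM⟩ := h.2 n
  obtain ⟨N, hN⟩ := k.2 n
  refine ⟨M + N, ?_⟩
  rintro x (⟨⟨s, b⟩, hs, ⟨t, c⟩, ht, hi, hb, hc⟩ | hx) hn
  · obtain rfl : b = false := hb
    obtain rfl : c = false := hc
    exact hi.length_le.trans (Nat.add_le_add (hM s hs (hi.count_left_le.trans hn))
      (hN t ht (hi.count_right_le.trans hn)))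
  · simp [hD] at hx

theorem hide {V' : Set Evt} (h : p.Fair V') (hA : V' ∩ A = ∅) (hV : V' ⊆ V) :
    (hide p A).Fair V := by
  have hD : hideD p A = ∅ := by
    refine Set.eq_empty_of_forall_notMem ?_
    rintro x (⟨t, r, ht, -⟩ | ⟨w, N, r, hw, hN, -⟩)
    · simp [h.1] at ht
    · obtain ⟨M, hM⟩ := h.2 N
      -- From position `N` on all events of `w` are hidden, hence outside `V'`. So `N` bounds the
      -- events from `V'` in every prefix, while the length `N + M + 1` exceeds the bound `M` for
      -- such traces.
      have hle : count V' (initSeg w (N + M + 1)) ≤ N := by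
        rw [← count_hideList hA, hideList_initSeg hN (by omega), count_hideList hA]
        simpa using count_le_length (U := V') (s := initSeg w N)
      have := hM _ (hw _) hle
      rw [length_initSeg] at this
      omega
  refine ⟨hD, fun n => (h.2 n).imp fun M hM => ?_⟩
  rintro x (⟨⟨s, b⟩, hs, e⟩ | hx) hn
  · simp only [Trace.hide, Trace.mk.injEq] at e
    obtain ⟨rfl, rfl⟩ := e
    refine length_hideList_le.trans (hM s hs ?_)
    rw [← count_hideList hA]
    exact (count_mono hV).trans hn
  · simp [hD] at hx

theorem rename {R : Evt → Evt → Prop} (h : p.Fair U) (hR : relImage R U ⊆ V) :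
    (rename p R).Fair V := by
  have hD : renameD p R = ∅ := by simp [renameD, h.1]
  refine ⟨hD, fun n => (h.2 n).imp fun M hM => ?_⟩
  rintro x (⟨⟨s, b⟩, hs, hst, hb⟩ | hx) hn
  · obtain rfl : b = false := hb
    rw [← hst.length_eq]
    exact hM s hs ((count_le_of_forall₂ hst hR).trans hn)
  · simp [hD] at hx

/-- At precision `n + 1` a trace with at most `n` events from `V` cannot use the escape clause, so
it is a trace of the fair approximant and inherits its bound. Divergences are excluded likewise. -/
theorem of_approx (h : ∀ n, ∃ q, q.Fair V ∧ ApproxLE V n q p) : p.Fair V := by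
  refine ⟨Set.eq_empty_of_forall_notMem fun x hx => ?_, fun n => ?_⟩
  · obtain ⟨q, hq, hqp⟩ := h (count V x.events + 1)
    rcases hqp.divs x hx with e | e
    · simp [hq.1] at e
    · exact absurd e.le_count (by omega)
  · obtain ⟨q, hq, hqp⟩ := h (n + 1)
    obtain ⟨M, hM⟩ := hq.2 n
    refine ⟨M, fun s hs hn => ?_⟩
    rcases hqp.traces _ hs with e | e
    · exact hM s e hn
    · exact absurd (e.le_count.trans hn) (by omega)

/-- Fixed-point induction would start from the bottom element, which diverges and is not fair.
Instead the iterates of `f` start from a fair process; contraction makes the `n`-th one approximate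
the fixed point to precision `n`, wherever the iteration starts. -/
theorem lfp {f : Denot Evt →o Denot Evt} (hf : ∀ x, x.Fair V → (f x).Fair V)
    (hc : ∀ n x y, ApproxLE V n x y → ApproxLE V (n + 1) (f x) (f y)) :
    (OrderHom.lfp f).Fair V := by
  refine of_approx fun n => ⟨f^[n] Denot.deadlock, ?_, ?_⟩
  · induction n with
    | zero => exact deadlock
    | succ n ih => rw [iterate_succ_apply']; exact hf _ ih
  · induction n with
    | zero => exact .zero _ _
    | succ n ih =>
      rw [iterate_succ_apply', ← OrderHom.map_lfp f]
      exact hc _ _ _ ih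

end Fair

end Denot

-- Denotations as functions of one variable; soundness of the nonexpansive sets

open Denot

variable {Evt : Type*} {Var : Type*} [DecidableEq Var]

/-- The function whose least fixed point is the denotation of `μ X.P`. -/
noncomputable def Term.body (P : Term Evt Var) (X : Var) (ρ : Var → Denot Evt) :
    Denot Evt →o Denot Evt :=
  ⟨fun x => P.eval (update ρ X x), fun _ _ h =>
    P.eval.monotone (update_le_update_iff.2 ⟨h, fun _ _ => le_rfl⟩)⟩

theorem Term.eval_mu (P : Term Evt Var) (X : Var) (ρ : Var → Denot Evt) :
    (Term.mu X P).eval ρ = OrderHom.lfp (P.body X ρ) := by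
  simp only [Term.eval]; rfl

theorem Term.eval_congr (P : Term Evt Var) {ρ σ : Var → Denot Evt}
    (h : ∀ X ∈ P.freeVars, ρ X = σ X) : P.eval ρ = P.eval σ := by
  induction P generalizing ρ σ with
  | deadlock => rfl
  | skip => rfl
  | div => rfl
  | var X => exact h X (by simp [Term.freeVars])
  | pre a P ih => exact congrArg (Denot.pre a) (ih h)
  | hide P A ih => exact congrArg (Denot.hide · A) (ih h)
  | rename P R ih => exact congrArg (Denot.rename · R) (ih h)
  | intChoice P Q ihP ihQ =>
    exact congrArg₂ Denot.choice (ihP fun X hX => h X (Finset.mem_union_left _ hX))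
      (ihQ fun X hX => h X (Finset.mem_union_right _ hX))
  | extChoice P Q ihP ihQ =>
    exact congrArg₂ Denot.choice (ihP fun X hX => h X (Finset.mem_union_left _ hX))
      (ihQ fun X hX => h X (Finset.mem_union_right _ hX))
  | par A P Q ihP ihQ =>
    exact congrArg₂ (Denot.par A) (ihP fun X hX => h X (Finset.mem_union_left _ hX))
      (ihQ fun X hX => h X (Finset.mem_union_right _ hX))
  | seq P Q ihP ihQ =>
    exact congrArg₂ Denot.seq (ihP fun X hX => h X (Finset.mem_union_left _ hX))
      (ihQ fun X hX => h X (Finset.mem_union_right _ hX))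
  | mu Y P ih =>
    rw [Term.eval_mu, Term.eval_mu]
    congr 1
    refine OrderHom.ext _ _ (funext fun x => ih fun X hX => ?_)
    by_cases e : X = Y
    · subst e; simp
    · simpa [e] using h X (by simp [Term.freeVars, e, hX])

theorem Term.eval_update_of_notMem {P : Term Evt Var} {X : Var} (h : X ∉ P.freeVars)
    (ρ : Var → Denot Evt) (p q : Denot Evt) :
    P.eval (update ρ X p) = P.eval (update ρ X q) :=
  P.eval_congr fun Y hY => by
    have : Y ≠ X := fun e => h (e ▸ hY)
    simp [this]

/-- Raising the precision from `n` to `m` events, the denotation of `P` as a function of `X`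
maps `U`-approximations to `V`-approximations. -/
def Term.MapsApprox (P : Term Evt Var) (X : Var) (U V : Set Evt) (n m : ℕ) : Prop :=
  ∀ (ρ : Var → Denot Evt) (p q : Denot Evt), ApproxLE U n p q →
    ApproxLE V m (P.eval (update ρ X p)) (P.eval (update ρ X q))

namespace Term.MapsApprox

theorem of_notMem {P : Term Evt Var} {X : Var} {U V : Set Evt} {n m : ℕ}
    (h : X ∉ P.freeVars) : P.MapsApprox X U V n m := fun ρ p q _ => by
  rw [Term.eval_update_of_notMem h ρ p q]
  exact .refl _

theorem mu {P : Term Evt Var} {X Y : Var} {U V U' V' : Set Evt} {n m : ℕ}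
    (hX : X ∈ (Term.mu Y P).freeVars) (h : P.MapsApprox X U' V' n m)
    (k : P.MapsApprox Y V' V' m m) (hU : U ⊆ U') (hV : V' ⊆ V) :
    (Term.mu Y P).MapsApprox X U V n m := by
  intro ρ p q hpq
  have hXY : X ≠ Y := (Finset.mem_erase.1 hX).1
  rw [Term.eval_mu, Term.eval_mu]
  refine ApproxLE.mono (ApproxLE.lfp fun x y hxy => ?_) hV
  -- The two variables are changed one at a time: `X` raises the precision from `n` to `m`, then `Y`
  -- has only to keep it at `m`.
  refine ApproxLE.trans (q := P.eval (update (update ρ X q) Y x)) ?_ (k _ _ _ hxy)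
  change ApproxLE V' m (P.eval (update (update ρ X p) Y x)) _
  rw [update_comm hXY, update_comm hXY]
  exact h _ _ _ (hpq.mono hU)

end Term.MapsApprox

/-- Nonexpansive sets are sound. -/
theorem mapsApprox_of_mem_nonexp (P : Term Evt Var) {X : Var} {U V : Set Evt}
    (h : (U, V) ∈ nonexp P X) (n : ℕ) : P.MapsApprox X U V n n := by
  induction P generalizing X U V with
  | deadlock => exact .of_notMem (by simp [Term.freeVars])
  | skip => exact .of_notMem (by simp [Term.freeVars])
  | div => exact .of_notMem (by simp [Term.freeVars])
  | var Y =>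
    by_cases hX : X ∉ (Term.var (Evt := Evt) Y).freeVars
    · exact .of_notMem hX
    rw [nonexp, if_neg hX] at h
    obtain rfl : X = Y := by simpa [Term.freeVars] using hX
    intro ρ p q hpq
    change ApproxLE V n (update ρ X p X) (update ρ X q X)
    simpa using hpq.mono h
  | pre a P ih =>
    by_cases hX : X ∉ (Term.pre a P).freeVars
    · exact .of_notMem hX
    rw [nonexp, if_neg hX] at h
    exact fun ρ p q hpq => (ih h ρ p q hpq).pre (Nat.le_add_right _ _)
  | hide P A ih =>
    by_cases hX : X ∉ (Term.hide P A).freeVars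
    · exact .of_notMem hX
    rw [nonexp, if_neg hX] at h
    obtain ⟨V', h, hA, hV⟩ := h
    exact fun ρ p q hpq => (ih h ρ p q hpq).hide hA hV
  | rename P R ih =>
    by_cases hX : X ∉ (Term.rename P R).freeVars
    · exact .of_notMem hX
    rw [nonexp, if_neg hX] at h
    obtain ⟨V', h, hR⟩ := h
    exact fun ρ p q hpq => (ih h ρ p q hpq).rename hR
  | intChoice P Q ihP ihQ =>
    by_cases hX : X ∉ (Term.intChoice P Q).freeVars
    · exact .of_notMem hX
    rw [nonexp, if_neg hX] at h
    exact fun ρ p q hpq => (ihP h.1 ρ p q hpq).choice (ihQ h.2 ρ p q hpq)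
  | extChoice P Q ihP ihQ =>
    by_cases hX : X ∉ (Term.extChoice P Q).freeVars
    · exact .of_notMem hX
    rw [nonexp, if_neg hX] at h
    exact fun ρ p q hpq => (ihP h.1 ρ p q hpq).choice (ihQ h.2 ρ p q hpq)
  | par A P Q ihP ihQ =>
    by_cases hX : X ∉ (Term.par A P Q).freeVars
    · exact .of_notMem hX
    rw [nonexp, if_neg hX] at h
    exact fun ρ p q hpq => (ihP h.1 ρ p q hpq).par (ihQ h.2 ρ p q hpq)
  | seq P Q ihP ihQ =>
    by_cases hX : X ∉ (Term.seq P Q).freeVars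
    · exact .of_notMem hX
    rw [nonexp, if_neg hX] at h
    exact fun ρ p q hpq => (ihP h.1 ρ p q hpq).seq_left.trans
      ((ihQ h.2 ρ p q hpq).seq_right fun _ _ => Nat.le_add_right _ _)
  | mu Y P ih =>
    by_cases hX : X ∉ (Term.mu Y P).freeVars
    · exact .of_notMem hX
    rw [nonexp, if_neg hX] at h
    obtain ⟨U', V', h, k, hU, hV⟩ := h
    exact .mu (not_not.1 hX) (ih h) (ih k) hU hV

-- Joint soundness of the guard, contractive and fair sets

/-- `p` satisfies the fairness hypothesis on the values of the free variables of `P`. -/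
def Term.FairEnv (P : Term Evt Var) (ρ : Var → Denot Evt) (U : Set Evt) : Prop :=
  ∀ X ∈ P.freeVars, (ρ X).Fair U

/-- Membership in the guard, contractive and fair sets of `P` has the intended meaning. -/
structure Term.Sound (P : Term Evt Var) : Prop where
  guarded : ∀ V ∈ guards P, ∀ ρ, (P.eval ρ).Guarded V
  contracts : ∀ X U V, (U, V) ∈ contr P X → ∀ n, P.MapsApprox X U V n (n + 1)
  fair : ∀ U V, (U, V) ∈ fair P → ∀ ρ, P.FairEnv ρ U → (P.eval ρ).Fair V

namespace Term.Sound

variable {P Q : Term Evt Var}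

theorem fair_of_closed (h : P.Sound) (hc : P.Closed) {U V : Set Evt}
    (hF : (U, V) ∈ CSP.fair P) (ρ : Var → Denot Evt) : (P.eval ρ).Fair V :=
  h.fair U V hF ρ fun X hX => by
    rw [Term.Closed] at hc
    simp [hc] at hX

theorem D_eq_empty_of_closed (h : P.Sound) (hc : P.Closed) (hF : (CSP.fair P).Nonempty)
    (ρ : Var → Denot Evt) : (P.eval ρ).D = ∅ :=
  let ⟨⟨_, _⟩, hUV⟩ := hF
  (h.fair_of_closed hc hUV ρ).D_eq_empty

theorem of_freeVars_eq_empty (hv : P.freeVars = ∅)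
    (hG : ∀ V ∈ guards P, ∀ ρ, (P.eval ρ).Guarded V)
    (hF : ∀ U V, (U, V) ∈ CSP.fair P → ∀ ρ, P.FairEnv ρ U → (P.eval ρ).Fair V) : P.Sound :=
  ⟨hG, fun _ _ _ _ _ => .of_notMem (by simp [hv]), hF⟩

theorem deadlock : (Term.deadlock : Term Evt Var).Sound :=
  of_freeVars_eq_empty rfl
    (fun V _ ρ t ht => by simp [Term.eval, Denot.deadlock] at ht)
    (fun _ _ _ _ _ => .deadlock)

theorem skip : (Term.skip : Term Evt Var).Sound :=
  of_freeVars_eq_empty rfl (fun _ h => by simp [guards] at h) (fun _ _ _ _ _ => .skip)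

theorem div : (Term.div : Term Evt Var).Sound :=
  of_freeVars_eq_empty rfl (fun _ h => by simp [guards] at h) (fun _ _ h => by simp [CSP.fair] at h)

theorem var (X : Var) : (Term.var X : Term Evt Var).Sound where
  guarded _ h := by simp [guards] at h
  contracts Y U V h n := by
    by_cases hX : Y ∉ (Term.var (Evt := Evt) X).freeVars
    · exact .of_notMem hX
    · simp [contr, not_not.1 hX] at h
  fair U V h ρ hρ := by
    rw [CSP.fair] at h
    exact (hρ X (by simp [Term.freeVars])).mono h

theorem pre (a : Evt) (h : P.Sound) : (Term.pre a P).Sound where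
  guarded V hV ρ := by
    rw [guards] at hV
    exact guarded_pre (hV.imp_left fun e => h.guarded V e ρ)
  contracts X U V hUV n := by
    by_cases hX : X ∉ (Term.pre a P).freeVars
    · exact .of_notMem hX
    rw [contr, if_neg hX] at hUV
    intro ρ p q hpq
    rcases hUV with hUV | ⟨hUV, ha⟩
    · exact (h.contracts X U V hUV n ρ p q hpq).pre (Nat.le_add_right _ _)
    · refine (mapsApprox_of_mem_nonexp P hUV n ρ p q hpq).pre ?_
      rw [Trace.count_cons_of_mem ha, Trace.count_nil]
  fair U V hUV ρ hρ := by
    rw [CSP.fair] at hUV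
    exact (h.fair U V hUV ρ hρ).pre

theorem intChoice (h : P.Sound) (k : Q.Sound) : (Term.intChoice P Q).Sound where
  guarded V hV ρ := by
    rw [guards] at hV
    exact (h.guarded V hV.1 ρ).choice (k.guarded V hV.2 ρ)
  contracts X U V hUV n := by
    by_cases hX : X ∉ (Term.intChoice P Q).freeVars
    · exact .of_notMem hX
    rw [contr, if_neg hX] at hUV
    exact fun ρ p q hpq =>
      (h.contracts X U V hUV.1 n ρ p q hpq).choice (k.contracts X U V hUV.2 n ρ p q hpq)
  fair U V hUV ρ hρ := by
    rw [CSP.fair] at hUV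
    exact (h.fair U V hUV.1 ρ fun X hX => hρ X (Finset.mem_union_left _ hX)).choice
      (k.fair U V hUV.2 ρ fun X hX => hρ X (Finset.mem_union_right _ hX))

theorem extChoice (h : P.Sound) (k : Q.Sound) : (Term.extChoice P Q).Sound where
  guarded V hV ρ := by
    rw [guards] at hV
    exact (h.guarded V hV.1 ρ).choice (k.guarded V hV.2 ρ)
  contracts X U V hUV n := by
    by_cases hX : X ∉ (Term.extChoice P Q).freeVars
    · exact .of_notMem hX
    rw [contr, if_neg hX] at hUV
    exact fun ρ p q hpq =>
      (h.contracts X U V hUV.1 n ρ p q hpq).choice (k.contracts X U V hUV.2 n ρ p q hpq)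
  fair U V hUV ρ hρ := by
    rw [CSP.fair] at hUV
    exact (h.fair U V hUV.1 ρ fun X hX => hρ X (Finset.mem_union_left _ hX)).choice
      (k.fair U V hUV.2 ρ fun X hX => hρ X (Finset.mem_union_right _ hX))

theorem seq (h : P.Sound) (k : Q.Sound) : (Term.seq P Q).Sound where
  guarded V hV ρ := by
    rw [guards] at hV
    rcases hV with ⟨hc, hF, hV | hV⟩ | ⟨-, hV⟩
    · exact (h.guarded V hV ρ).seq_left
    · exact (k.guarded V hV ρ).seq_right (h.D_eq_empty_of_closed hc hF ρ)
    · exact (h.guarded V hV ρ).seq_left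
  contracts X U V hUV n := by
    by_cases hX : X ∉ (Term.seq P Q).freeVars
    · exact .of_notMem hX
    rw [contr, if_neg hX] at hUV
    intro ρ p q hpq
    refine (h.contracts X U V hUV.1 n ρ p q hpq).seq_left.trans ?_
    rcases hUV.2 with hQ | ⟨hQ, hG⟩
    · exact (k.contracts X U V hQ n ρ p q hpq).seq_right fun _ _ => Nat.le_add_right _ _
    -- The extra unit of precision is the event from `V` that guards termination of `P`.
    · exact (mapsApprox_of_mem_nonexp Q hQ n ρ p q hpq).seq_right fun t ht =>
        Nat.add_le_add_left (h.guarded V hG _ t ht) n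
  fair U V hUV ρ hρ := by
    rw [CSP.fair] at hUV
    exact (h.fair U V hUV.1 ρ fun X hX => hρ X (Finset.mem_union_left _ hX)).seq
      (k.fair U V hUV.2 ρ fun X hX => hρ X (Finset.mem_union_right _ hX))

theorem par (A : Set Evt) (h : P.Sound) (k : Q.Sound) : (Term.par A P Q).Sound where
  guarded V hV ρ := by
    rw [guards] at hV
    change (Denot.par A (P.eval ρ) (Q.eval ρ)).Guarded V
    rcases hV with ⟨hP, hPF, hQ, hQF, hV⟩ | ⟨-, hV⟩
    · have hPD := h.D_eq_empty_of_closed hP hPF ρ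
      have hQD := k.D_eq_empty_of_closed hQ hQF ρ
      rcases hV with hV | hV
      · exact (h.guarded V hV ρ).par_left_of_D_eq_empty hPD hQD
      · rw [par_comm]
        exact (k.guarded V hV ρ).par_left_of_D_eq_empty hQD hPD
    · exact (h.guarded V hV.1 ρ).par (k.guarded V hV.2 ρ)
  contracts X U V hUV n := by
    by_cases hX : X ∉ (Term.par A P Q).freeVars
    · exact .of_notMem hX
    rw [contr, if_neg hX] at hUV
    exact fun ρ p q hpq =>
      (h.contracts X U V hUV.1 n ρ p q hpq).par (k.contracts X U V hUV.2 n ρ p q hpq)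
  fair U V hUV ρ hρ := by
    rw [CSP.fair] at hUV
    have hP : P.FairEnv ρ U := fun X hX => hρ X (Finset.mem_union_left _ hX)
    have hQ : Q.FairEnv ρ U := fun X hX => hρ X (Finset.mem_union_right _ hX)
    change (Denot.par A (P.eval ρ) (Q.eval ρ)).Fair V
    rcases hUV with (⟨hPF, hQF⟩ | ⟨U₁, U₂, V₁, hPF, hQF, e⟩) | ⟨U₁, U₂, V₂, hQF, hPF, e⟩
    · exact (h.fair U V hPF ρ hP).par (k.fair U V hQF ρ hQ)
    · obtain ⟨rfl, rfl⟩ := Prod.mk.inj e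
      exact (h.fair U₁ V hPF ρ fun X hX => (hP X hX).mono Set.inter_subset_left).par_of_left
        (k.fair U₂ A hQF ρ fun X hX => (hQ X hX).mono Set.inter_subset_right)
    · obtain ⟨rfl, rfl⟩ := Prod.mk.inj e
      rw [par_comm]
      exact (k.fair U₂ V hQF ρ fun X hX => (hQ X hX).mono Set.inter_subset_right).par_of_left
        (h.fair U₁ A hPF ρ fun X hX => (hP X hX).mono Set.inter_subset_left)

theorem hide (A : Set Evt) (h : P.Sound) : (Term.hide P A).Sound where
  guarded V hV ρ := by
    rw [guards] at hV
    obtain ⟨hc, hF, V', hG, hA, hV'⟩ := hV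
    -- Fairness of `P` for the complement of `A` rules out infinite hidden runs, so hiding creates
    -- no divergence.
    exact ((h.guarded V' hG ρ).hide hA
      ((h.fair_of_closed hc hF ρ).hide (Set.compl_inter_self A) subset_rfl).D_eq_empty).mono hV'
  contracts X U V hUV n := by
    by_cases hX : X ∉ (Term.hide P A).freeVars
    · exact .of_notMem hX
    rw [contr, if_neg hX] at hUV
    obtain ⟨V', hUV, hA, hV⟩ := hUV
    exact fun ρ p q hpq => (h.contracts X U V' hUV n ρ p q hpq).hide hA hV
  fair U V hUV ρ hρ := by
    rw [CSP.fair] at hUV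
    obtain ⟨V', hUV, hA, hV⟩ := hUV
    exact (h.fair U V' hUV ρ hρ).hide hA hV

theorem rename (R : Evt → Evt → Prop) (h : P.Sound) : (Term.rename P R).Sound where
  guarded V hV ρ := by
    rw [guards] at hV
    obtain ⟨V', hG, hR⟩ := hV
    exact (h.guarded V' hG ρ).rename hR
  contracts X U V hUV n := by
    by_cases hX : X ∉ (Term.rename P R).freeVars
    · exact .of_notMem hX
    rw [contr, if_neg hX] at hUV
    obtain ⟨V', hUV, hR⟩ := hUV
    exact fun ρ p q hpq => (h.contracts X U V' hUV n ρ p q hpq).rename hR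
  fair U V hUV ρ hρ := by
    rw [CSP.fair] at hUV
    obtain ⟨V', hUV, hR⟩ := hUV
    exact (h.fair U V' hUV ρ hρ).rename hR

theorem mu (Y : Var) (h : P.Sound) : (Term.mu Y P).Sound where
  guarded V hV ρ := by
    rw [guards] at hV
    -- Guardedness of `P` holds for all values of its variables, so one unfolding of the fixed point
    -- suffices.
    rw [Term.eval_mu, ← OrderHom.map_lfp]
    exact h.guarded V hV _
  contracts X U V hUV n := by
    by_cases hX : X ∉ (Term.mu Y P).freeVars
    · exact .of_notMem hX
    rw [contr, if_neg hX] at hUV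
    obtain ⟨U', V', hUV, hN, hU, hV⟩ := hUV
    exact .mu (not_not.1 hX) (h.contracts X U' V' hUV n) (mapsApprox_of_mem_nonexp P hN _) hU hV
  fair U V hUV ρ hρ := by
    rw [CSP.fair] at hUV
    obtain ⟨W, hC, hF, hU, hV⟩ := hUV
    rw [Term.eval_mu]
    refine Fair.mono (Fair.lfp (fun x hx => h.fair W W hF _ fun X hX => ?_)
      fun n x y hxy => h.contracts Y W W hC n ρ x y hxy) hV
    by_cases e : X = Y
    · subst e
      simpa using hx
    · have hmem : X ∈ (Term.mu Y P).freeVars := Finset.mem_erase.2 ⟨e, hX⟩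
      -- A free variable other than `Y` makes the recursion open, which is exactly when the
      -- inclusion in `W` is available.
      have hopen : ¬ (Term.mu Y P).Closed := fun hc => by
        rw [Term.Closed] at hc
        simp [hc] at hmem
      simpa [e] using (hρ X hmem).mono (hU hopen)

end Term.Sound

/-- The three properties must be carried together: contraction of a sequential composition uses
guards, guards of a composite use fairness, and fairness of a recursion uses contraction of its
body. -/
theorem Term.sound (P : Term Evt Var) : P.Sound := by
  induction P with
  | deadlock => exact .deadlock
  | skip => exact .skip
  | div => exact .div
  | var X => exact .var X
  | pre a P ih => exact ih.pre a
  | hide P A ih => exact ih.hide A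
  | rename P R ih => exact ih.rename R
  | intChoice P Q ihP ihQ => exact ihP.intChoice ihQ
  | extChoice P Q ihP ihQ => exact ihP.extChoice ihQ
  | par A P Q ihP ihQ => exact ihP.par A ihQ
  | seq P Q ihP ihQ => exact ihP.seq ihQ
  | mu Y P ih => exact ih.mu Y

end CSP

theorem proposition5p3 {Evt : Type*} [Finite Evt] {Var : Type*} [DecidableEq Var]
    (P : CSP.Term Evt Var) (X : Var) (U V : Set Evt) (hUV : (U, V) ∈ CSP.contr P X)
    (T₁ T₂ : CSP.Denot Evt) (θ : Var → CSP.Denot Evt) :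
    CSP.Denot.dist V (P.eval (Function.update θ X T₁)) (P.eval (Function.update θ X T₂)) ≤
      1 / 2 * CSP.Denot.dist U T₁ T₂ :=
  CSP.Denot.dist_le_half_mul_dist
    (fun n p q h => P.sound.contracts X U V hUV n θ p q h) T₁ T₂
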